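/- **Language.** Internal terms are built from variables $x,y,\dots$ (countably many) by a constant $c$ and a unary symbol $f$; external terms are built from variables $X,Y,\dots$ by $C$ and $F$. The set $F_{i,r}$ of internal relational formulas consists of the finitary first-order formulas (connectives $\neg,\wedge,\vee,\to$, quantifiers $\forall,\exists$) over $=,<,f,c$, of the infinitary disjunctions $\bigvee_{n\in\omega}(t<f^n(c))$ for terms $t$, and of $\forall x\bigvee_{n\in\omega}(x<f^n(c))$; $F_{e,r}$ is the same with external symbols; $s\le t$ abbreviates $s<t\vee s=t$. Internal temporal formulas are built from propositional letters $p_n$ ($n\in\omega$) by $\neg,\wedge,\vee,\to$ and $\Box_I$, where $I$ is one of $[m,n],\,]m,n],\,[m,n[,\,]m,n[,\,[m,\infty[,\,]m,\infty[$ with $m<n$ in $\omega$. External temporal formulas are built by the same operations from the expressions $t:\psi$, with $t$ an internal term and $\psi$ an internal temporal formula. The formulas occurring in sequents are those of $F_{e,r}$ and the $S:\beta$ with $S$ an external term and $\beta$ in $F_{i,r}$ or external temporal. Sequents $\Gamma\vdash\Delta$ are pairs of finite lists of such formulas. **Semantics.** A time flow is a dense linear order with least element $0$ and no greatest element, with a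 strictly increasing $g$ such that $a<g(a)$ for all $a$ and $\{g^n(0)\}_n$ is cofinal. A pre-structure is a time flow $\mathbf M$ with a time flow $\mathbf N_a$ for each $a\in M$; a structure $\mathcal M$ adds subsets $p^{\mathbf N_a}\subseteq N_a$ for all propositional letters $p$, and assignments $\sigma$ of the external variables in $M$ and $\sigma_a$ of the internal variables in $N_a$. Relational formulas have their first-order meaning in $\mathbf M,\sigma$; $S:\varphi$ with $\varphi\in F_{i,r}$ is true iff $\mathbf N_a,\sigma_a\models\varphi$, where $a$ is the value of $S$. At the point $b\in N_a$, $p$ holds iff $b\in p^{\mathbf N_a}$, connectives are as usual, and $\Box_{[m,n]}\eta$ holds iff $\eta$ holds at all $d$ with $g_a^m(b)\le d\le g_a^n(b)$ (similarly for the other intervals). At the point $a\in M$, $t:\psi$ holds iff $\psi$ holds at the value of $t$ in $\mathbf N_a,\sigma_a$, and connectives and $\Box_I$ are treated as before, over $\mathbf M$. Finally $S:\beta$ is true iff $\beta$ holds at the value of $S$. A sequent is true in $\mathcal M$ iff some formula of its antecedent is false or some formula of its succedent is true. **Axioms.** Besides the identity axioms $A\vdash A$, they are all instances, for external terms $S,T,U$,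 an external variable $Z$ and an atomic $\rho\in F_{e,r}$, of $\vdash S=S$; $\ S=T,\rho[S/Z]\vdash\rho[T/Z]$; $\ S<S\vdash$; $\ S<T,T<U\vdash S<U$; $\ \vdash S<T,S=T,T<S$; $\ \vdash C<S,C=S$; $\ S<T\vdash\exists Z(S<Z\wedge Z<T)$ ($Z$ not in $S,T$); $\ \vdash S<F(S)$; $\ S<T\vdash F(S)<F(T)$; $\ \vdash\bigvee_{n}(S<F^n(C))$; the internal versions of all these, with every formula labelled by one and the same external term; and $T=S,\ T:\eta\vdash S:\eta$ for $\eta$ an atomic formula in $F_{i,r}$ or of the form $t:\psi$; $\ T:t=s,\ T:t:p\vdash T:s:p$ for $p$ a propositional letter. **Reduction tree of $\Gamma\vdash\Delta$.** Fix an ordering (a finite list) of the formulas of $\Gamma\vdash\Delta$; an enumeration of the axioms other than the identity axioms in which each occurs infinitely often; enumerations of the internal and of the external terms; and a choice, at each node, of an internal and an external variable that are not free in its sequent. The nodes are sequents with an ordering of their formulas; the root is $\Gamma\vdash\Delta$. A node is closed (a leaf) if it follows by weakening, exchange and contraction from an axiom. Otherwise, let $\Gamma'\vdash\Delta'$ be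 its sequent and $A_1,\dots,A_q$ its ordering. (i) If $q=0$ or $A_1$ is atomic (that is, $A_1$ is an atomic formula of $F_{e,r}$, or $T:\rho$ with $\rho\in F_{i,r}$ atomic, or $T:t:p$), examine the next axiom $B_1,\dots,B_k\vdash D_1,\dots,D_m$ of the enumeration, i.e. the one with index the number of earlier applications of (i) on the branch. If all $B_j$ occur in $\Gamma'$, the children are $\Gamma',D_i\vdash\Delta'$ with ordering $A_2,\dots,A_q,D_i,A_1$, for $1\le i\le m$. Otherwise the only child is $\Gamma'\vdash\Delta'$ with ordering $A_2,\dots,A_q,A_1$. (ii) If $A_1$ is not atomic, the children add to $\Gamma'\vdash\Delta'$ the new formulas of the premisses of the rule for $A_1$ on its side, and the ordering becomes $A_2,\dots,A_q$, new formulas, $A_1$. The new formulas are as follows ("L" means added to the antecedent, "R" to the succedent; "|" separates children; each line applies at every level at which the connective occurs, all labels being kept, so that e.g. $\alpha$ stands for $T:t:\alpha$ in the case of $T:t:(\alpha\to\beta)$). - In the antecedent: $\neg\alpha$: R $\alpha$. $\alpha\wedge\beta$: L $\alpha,\beta$. $\alpha\vee\beta$: L $\alpha$ | L $\beta$. $\alpha\to\beta$: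 L $\beta$ | R $\alpha$. $\forall x\varphi$: L $\varphi[u/x]$. $\exists x\varphi$: L $\varphi[y/x]$. $\bigvee_n(t<f^n(c))$: L $t<f^i(c)$, one child for each $i\in\omega$. $\forall x\bigvee_n(x<f^n(c))$: L $\bigvee_n(u<f^n(c))$. $T:t:\Box_{[m,n]}\eta$: R $T:f^m(t)\le u$ | R $T:u\le f^n(t)$ | L $T:u:\eta$. $T:\Box_{[m,n]}\alpha$: R $F^m(T)\le u$ | R $u\le F^n(T)$ | L $u:\alpha$. - In the succedent: $\neg\alpha$: L $\alpha$. $\alpha\wedge\beta$: R $\alpha$ | R $\beta$. $\alpha\vee\beta$: R $\alpha,\beta$. $\alpha\to\beta$: L $\alpha$, R $\beta$. $\forall x\varphi$: R $\varphi[y/x]$. $\exists x\varphi$: R $\varphi[u/x]$. $\bigvee_n(t<f^n(c))$: R $t<f^k(c)$, with $k$ least such that this (labelled) formula is not in $\Delta'$. $\forall x\bigvee_n(x<f^n(c))$: R $\bigvee_n(y<f^n(c))$. $T:t:\Box_{[m,n]}\eta$: L $T:f^m(t)\le y,\ T:y\le f^n(t)$, R $T:y:\eta$. $T:\Box_{[m,n]}\alpha$: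 L $F^m(T)\le y,\ y\le F^n(T)$, R $y:\alpha$. For the other intervals, $\le$ is replaced by $<$ at excluded endpoints, and the condition on the right endpoint is absent when it is $\infty$. Here $u$ is the first term (internal or external, as appropriate) of the enumeration not yet used on the branch for $A_1$, and $y$ is the chosen (internal or external) variable not free in $\Gamma'\vdash\Delta'$. **Theorem.** Let $(\Gamma_n\vdash\Delta_n)_{n\in\omega}$ be an infinite branch of the reduction tree of $\Gamma\vdash\Delta$, and put $\overline\Gamma=\bigcup_n\Gamma_n$, $\overline\Delta=\bigcup_n\Delta_n$. For external terms let $S\sim T$ iff $(S=T)\in\overline\Gamma$, and for each external term $S$ and internal terms $t,u$ let $t\sim_S u$ iff $(S:t=u)\in\overline\Gamma$. Then $\sim$ and all $\sim_S$ are equivalence relations, and the following is well defined, the internal items depending only on the $\sim$-class of $S$: $$M=\{T^\sim\},\quad F^{\mathbf M}(T^\sim)=F(T)^\sim,\quad C^{\mathbf M}=C^\sim,\quad S^\sim<T^\sim\iff(S<T)\in\overline\Gamma,\quad\sigma(X)=X^\sim,$$ $$N_{S}=\{t^S\},\quad f(t^S)=f(t)^S,\quad c^{\mathbf N_S}=c^S,\quad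 t^S<u^S\iff(S:t<u)\in\overline\Gamma,\quad p^{\mathbf N_S}=\{t^S:(S:t:p)\in\overline\Gamma\},\quad\sigma_S(x)=x^S,$$ where $T^\sim$ is the $\sim$-class of $T$ and $t^S$ the $\sim_S$-class of $t$, and $\mathbf N_{S^\sim}=\mathbf N_S$, $\sigma_{S^\sim}=\sigma_S$. The resulting $\mathcal M$ is a structure, that is, $\mathbf M$ and all $\mathbf N_a$ are time flows. Every formula in $\overline\Gamma$ is true in $\mathcal M$ and every formula in $\overline\Delta$ is false in $\mathcal M$. In particular $\Gamma\vdash\Delta$ is not true in $\mathcal M$. -/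

import Mathlib

namespace MTL2

/-! ### Relational language

The internal and the external relational languages are two copies of the same language
`{f, <, c}` with equality, so one type of terms and one type of formulas serves for both; whether
an occurrence is internal or external is decided by its place in a `Formula` (below). -/

/-- Terms over `c`, `f`, with free variables named by natural numbers and `k` bound variables. -/
inductive Tm (k : ℕ) : Type
  | var (x : ℕ) : Tm k
  | bnd (i : Fin k) : Tm k
  | c : Tm k
  | f (t : Tm k) : Tm k

/-- A term in the proper sense (no dangling bound variable). -/
abbrev Term : Type := Tm 0

/-- `t.iter n` is the term `fⁿ(t)`. -/
def Tm.iter {k : ℕ} (t : Tm k) : ℕ → Tm k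
  | 0 => t
  | n + 1 => (t.iter n).f

/-- Regard a term as a term in a context with `k` bound variables. -/
def Tm.weaken (k : ℕ) : Term → Tm k
  | .var x => .var x
  | .c => .c
  | .f t => .f (Tm.weaken k t)

/-- Replace the outermost bound variable (index `0`) by the term `u`. -/
def Tm.inst {k : ℕ} (u : Term) : Tm (k + 1) → Tm k
  | .var x => .var x
  | .bnd i => Fin.cases (u.weaken k) (fun j => .bnd j) i
  | .c => .c
  | .f t => .f (Tm.inst u t)

/-- `t[u/z]`: replace the free variable `z` by `u`. -/
def Tm.subst (z : ℕ) (u : Term) : Term → Term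
  | .var x => if x = z then u else .var x
  | .c => .c
  | .f t => .f (Tm.subst z u t)

/-- The free variable `x` occurs in the term. -/
def Tm.Occurs {k : ℕ} (x : ℕ) : Tm k → Prop
  | .var y => y = x
  | .bnd _ => False
  | .c => False
  | .f t => Tm.Occurs x t

/-- Atomic relational formulas. -/
inductive Atom (k : ℕ) : Type
  | eq (s t : Tm k) : Atom k
  | lt (s t : Tm k) : Atom k

def Atom.inst {k : ℕ} (u : Term) : Atom (k + 1) → Atom k
  | .eq s t => .eq (Tm.inst u s) (Tm.inst u t)
  | .lt s t => .lt (Tm.inst u s) (Tm.inst u t)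

def Atom.subst (z : ℕ) (u : Term) : Atom 0 → Atom 0
  | .eq s t => .eq (Tm.subst z u s) (Tm.subst z u t)
  | .lt s t => .lt (Tm.subst z u s) (Tm.subst z u t)

def Atom.Occurs {k : ℕ} (x : ℕ) : Atom k → Prop
  | .eq s t => s.Occurs x ∨ t.Occurs x
  | .lt s t => s.Occurs x ∨ t.Occurs x

/-- Finitary first-order formulas with `k` dangling bound variables. The quantifier in
`all φ`, `φ : FinForm (k+1)`, binds the last of the `k+1` bound variables. -/
inductive FinForm : ℕ → Type
  | atom {k : ℕ} (a : Atom k) : FinForm k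
  | neg {k : ℕ} (φ : FinForm k) : FinForm k
  | and {k : ℕ} (φ ψ : FinForm k) : FinForm k
  | or {k : ℕ} (φ ψ : FinForm k) : FinForm k
  | imp {k : ℕ} (φ ψ : FinForm k) : FinForm k
  | all {k : ℕ} (φ : FinForm (k + 1)) : FinForm k
  | ex {k : ℕ} (φ : FinForm (k + 1)) : FinForm k

/-- Replace the outermost bound variable by `u`; for `φ : FinForm 1`, this takes the matrix of
`∀ x φ` or `∃ x φ` to `φ[u/x]`. -/
def FinForm.inst (u : Term) : {k : ℕ} → FinForm (k + 1) → FinForm k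
  | _, .atom a => .atom (a.inst u)
  | _, .neg φ => .neg (φ.inst u)
  | _, .and φ ψ => .and (φ.inst u) (ψ.inst u)
  | _, .or φ ψ => .or (φ.inst u) (ψ.inst u)
  | _, .imp φ ψ => .imp (φ.inst u) (ψ.inst u)
  | _, .all φ => .all (φ.inst u)
  | _, .ex φ => .ex (φ.inst u)

def FinForm.Occurs (x : ℕ) : {k : ℕ} → FinForm k → Prop
  | _, .atom a => a.Occurs x
  | _, .neg φ => φ.Occurs x
  | _, .and φ ψ => φ.Occurs x ∨ ψ.Occurs x
  | _, .or φ ψ => φ.Occurs x ∨ ψ.Occurs x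
  | _, .imp φ ψ => φ.Occurs x ∨ ψ.Occurs x
  | _, .all φ => φ.Occurs x
  | _, .ex φ => φ.Occurs x

/-- Relational formulas: the finitary ones, the infinitary disjunctions `⋁ₙ (t < fⁿ(c))`,
and `∀ x ⋁ₙ (x < fⁿ(c))`. -/
inductive RForm : Type
  | fin (φ : FinForm 0) : RForm
  | bigOr (t : Term) : RForm
  | allBigOr : RForm

def RForm.Occurs (x : ℕ) : RForm → Prop
  | .fin φ => φ.Occurs x
  | .bigOr t => t.Occurs x
  | .allBigOr => False

abbrev RForm.eq (s t : Term) : RForm := .fin (.atom (.eq s t))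
abbrev RForm.lt (s t : Term) : RForm := .fin (.atom (.lt s t))
/-- `s ≤ t` abbreviates `s < t ∨ s = t`. -/
abbrev RForm.le (s t : Term) : RForm := .fin (.or (.atom (.lt s t)) (.atom (.eq s t)))

/-! ### Temporal and labelled formulas -/

/-- The intervals `(m,n)` indexing the temporal operators. A flag says whether the endpoint
is included. -/
inductive Ivl : Type
  | bounded (lclosed rclosed : Bool) (m n : ℕ) (h : m < n) : Ivl
  | unbounded (lclosed : Bool) (m : ℕ) : Ivl

/-- The relational formula `fᵐ(t) ≤ s`, or `fᵐ(t) < s` for an excluded endpoint. -/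
def lowerBound (closed : Bool) (m : ℕ) (t s : Term) : RForm :=
  if closed then .le (t.iter m) s else .lt (t.iter m) s

/-- The relational formula `s ≤ fⁿ(t)`, or `s < fⁿ(t)` for an excluded endpoint. -/
def upperBound (closed : Bool) (n : ℕ) (t s : Term) : RForm :=
  if closed then .le s (t.iter n) else .lt s (t.iter n)

/-- The relational formulas which together say that `s` lies in the interval based at `t`. -/
def Ivl.bounds : Ivl → Term → Term → List RForm
  | .bounded lc rc m n _, t, s => [lowerBound lc m t s, upperBound rc n t s]
  | .unbounded lc m, t, s => [lowerBound lc m t s]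

/-- Internal temporal formulas. -/
inductive ITemp : Type
  | prop (p : ℕ) : ITemp
  | neg (η : ITemp) : ITemp
  | and (η ξ : ITemp) : ITemp
  | or (η ξ : ITemp) : ITemp
  | imp (η ξ : ITemp) : ITemp
  | box (I : Ivl) (η : ITemp) : ITemp

/-- External temporal formulas: the closure of the internal labelled formulas `t : ψ`
under connectives and temporal operators. -/
inductive ETemp : Type
  | lab (t : Term) (ψ : ITemp) : ETemp
  | neg (α : ETemp) : ETemp
  | and (α β : ETemp) : ETemp
  | or (α β : ETemp) : ETemp
  | imp (α β : ETemp) : ETemp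
  | box (I : Ivl) (α : ETemp) : ETemp

/-- The internal free variable `x` occurs in the formula. -/
def ETemp.Occurs (x : ℕ) : ETemp → Prop
  | .lab t _ => t.Occurs x
  | .neg α => α.Occurs x
  | .and α β => α.Occurs x ∨ β.Occurs x
  | .or α β => α.Occurs x ∨ β.Occurs x
  | .imp α β => α.Occurs x ∨ β.Occurs x
  | .box _ α => α.Occurs x

/-- The formulas of sequents: external relational formulas `rel φ`, and external labelled
formulas `S : φ` with `φ` internal relational (`labR S φ`) or `S : β` with `β` external temporal
(`labT S β`). -/
inductive Formula : Type
  | rel (φ : RForm) : Formula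
  | labR (S : Term) (φ : RForm) : Formula
  | labT (S : Term) (β : ETemp) : Formula

/-- Atomic formulas, i.e. those to which no logical rule applies. -/
def Formula.IsAtomic : Formula → Prop
  | .rel (.fin (.atom _)) => True
  | .labR _ (.fin (.atom _)) => True
  | .labT _ (.lab _ (.prop _)) => True
  | _ => False

/-- The internal variable `x` occurs free in the formula. -/
def Formula.OccursI (x : ℕ) : Formula → Prop
  | .rel _ => False
  | .labR _ φ => φ.Occurs x
  | .labT _ β => β.Occurs x

/-- The external variable `x` occurs free in the formula. -/
def Formula.OccursE (x : ℕ) : Formula → Prop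
  | .rel φ => φ.Occurs x
  | .labR S _ => S.Occurs x
  | .labT S _ => S.Occurs x

/-- Whether the rules for a (non-atomic) formula instantiate external variables;
otherwise they instantiate internal variables. -/
def Formula.isExternal : Formula → Bool
  | .rel _ => true
  | .labR _ _ => false
  | .labT _ (.lab _ _) => false
  | .labT _ _ => true

/-- A sequent: antecedent and succedent. -/
abbrev Sequent : Type := List Formula × List Formula

/-! ### Semantics -/

/-- A first-order structure for the language `{f, <, c}`. -/
structure Flow (M : Type) where
  lt : M → M → Prop
  zero : M
  g : M → M

/-- Dense linear order with least element `zero` and no greatest element; `g` is strictly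
increasing, `a < g a`, and `gⁿ(zero)` is cofinal. -/
structure Flow.IsTimeFlow {M : Type} (F : Flow M) : Prop where
  irrefl : ∀ a, ¬ F.lt a a
  trans : ∀ a b d, F.lt a b → F.lt b d → F.lt a d
  total : ∀ a b, F.lt a b ∨ a = b ∨ F.lt b a
  dense : ∀ a b, F.lt a b → ∃ d, F.lt a d ∧ F.lt d b
  least : ∀ a, F.zero = a ∨ F.lt F.zero a
  no_greatest : ∀ a, ∃ b, F.lt a b
  mono : ∀ a b, F.lt a b → F.lt (F.g a) (F.g b)
  lt_g : ∀ a, F.lt a (F.g a)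
  cofinal : ∀ a, ∃ n : ℕ, F.lt a (F.g^[n] F.zero)

/-- Interpretation of a term under an assignment `σ` of the free and `e` of the bound variables. -/
def Tm.eval {M : Type} (F : Flow M) (σ : ℕ → M) {k : ℕ} (e : Fin k → M) : Tm k → M
  | .var x => σ x
  | .bnd i => e i
  | .c => F.zero
  | .f t => F.g (t.eval F σ e)

def Atom.Holds {M : Type} (F : Flow M) (σ : ℕ → M) {k : ℕ} (e : Fin k → M) : Atom k → Prop
  | .eq s t => s.eval F σ e = t.eval F σ e
  | .lt s t => F.lt (s.eval F σ e) (t.eval F σ e)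

def FinForm.Holds {M : Type} (F : Flow M) (σ : ℕ → M) :
    {k : ℕ} → (Fin k → M) → FinForm k → Prop
  | _, e, .atom a => a.Holds F σ e
  | _, e, .neg φ => ¬ φ.Holds F σ e
  | _, e, .and φ ψ => φ.Holds F σ e ∧ ψ.Holds F σ e
  | _, e, .or φ ψ => φ.Holds F σ e ∨ ψ.Holds F σ e
  | _, e, .imp φ ψ => φ.Holds F σ e → ψ.Holds F σ e
  | _, e, .all φ => ∀ d : M, φ.Holds F σ (Fin.snoc (α := fun _ => M) e d)
  | _, e, .ex φ => ∃ d : M, φ.Holds F σ (Fin.snoc (α := fun _ => M) e d)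

/-- Value of a term. -/
def Term.val {M : Type} (F : Flow M) (σ : ℕ → M) (t : Term) : M := Tm.eval F σ Fin.elim0 t

def RForm.Holds {M : Type} (F : Flow M) (σ : ℕ → M) : RForm → Prop
  | .fin φ => φ.Holds F σ Fin.elim0
  | .bigOr t => ∃ n : ℕ, F.lt (Term.val F σ t) (F.g^[n] F.zero)
  | .allBigOr => ∀ d : M, ∃ n : ℕ, F.lt d (F.g^[n] F.zero)

/-- `F.below closed a b` is `a ≤ b` if `closed` is true and `a < b` otherwise. -/
def Flow.below {M : Type} (F : Flow M) (closed : Bool) (a b : M) : Prop :=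
  F.lt a b ∨ (closed = true ∧ a = b)

/-- `d` lies in the interval based at the point `b`. -/
def Ivl.Mem {M : Type} (F : Flow M) (b d : M) : Ivl → Prop
  | .bounded lc rc m n _ => F.below lc (F.g^[m] b) d ∧ F.below rc d (F.g^[n] b)
  | .unbounded lc m => F.below lc (F.g^[m] b) d

/-- Truth of an internal temporal formula at the point `b`. -/
def ITemp.Holds {N : Type} (F : Flow N) (V : ℕ → Set N) : N → ITemp → Prop
  | b, .prop p => b ∈ V p
  | b, .neg η => ¬ η.Holds F V b
  | b, .and η ξ => η.Holds F V b ∧ ξ.Holds F V b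
  | b, .or η ξ => η.Holds F V b ∨ ξ.Holds F V b
  | b, .imp η ξ => η.Holds F V b → ξ.Holds F V b
  | b, .box I η => ∀ d : N, I.Mem F b d → η.Holds F V d

/-- The data of a structure `(𝐌, 𝐍ₐ, (p^𝐍ₐ)ₚ, σ, σₐ)`. -/
structure Interp where
  M : Type
  flow : Flow M
  N : M → Type
  flowI : ∀ a, Flow (N a)
  val : ∀ a, ℕ → Set (N a)
  σ : ℕ → M
  σI : ∀ a, ℕ → N a

/-- The pre-structure axioms. -/
def Interp.IsStructure (𝓜 : Interp) : Prop :=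
  𝓜.flow.IsTimeFlow ∧ ∀ a, (𝓜.flowI a).IsTimeFlow

/-- Truth of an external temporal formula at the point `a` of the external flow. -/
def ETemp.Holds (𝓜 : Interp) : 𝓜.M → ETemp → Prop
  | a, .lab t ψ => ψ.Holds (𝓜.flowI a) (𝓜.val a) (Term.val (𝓜.flowI a) (𝓜.σI a) t)
  | a, .neg α => ¬ α.Holds 𝓜 a
  | a, .and α β => α.Holds 𝓜 a ∧ β.Holds 𝓜 a
  | a, .or α β => α.Holds 𝓜 a ∨ β.Holds 𝓜 a
  | a, .imp α β => α.Holds 𝓜 a → β.Holds 𝓜 a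
  | a, .box I α => ∀ d : 𝓜.M, I.Mem 𝓜.flow a d → α.Holds 𝓜 d

/-- `𝓜 ⊨ A`. -/
def Interp.Sat (𝓜 : Interp) : Formula → Prop
  | .rel φ => φ.Holds 𝓜.flow 𝓜.σ
  | .labR S φ => φ.Holds (𝓜.flowI (Term.val 𝓜.flow 𝓜.σ S)) (𝓜.σI (Term.val 𝓜.flow 𝓜.σ S))
  | .labT S β => β.Holds 𝓜 (Term.val 𝓜.flow 𝓜.σ S)

/-- `𝓜 ⊨ Γ ⊢ Δ`. -/
def Interp.SatSeq (𝓜 : Interp) (s : Sequent) : Prop :=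
  (∃ A ∈ s.1, ¬ 𝓜.Sat A) ∨ ∃ B ∈ s.2, 𝓜.Sat B

/-! ### Axioms of the calculus -/

/-- Instances of the schemas for equality and of the extralogical schemas, in the
relational language. -/
inductive RelAxiom : List RForm → List RForm → Prop
  | refl (t : Term) : RelAxiom [] [.eq t t]
  | subst (ρ : Atom 0) (z : ℕ) (s t : Term) :
      RelAxiom [.eq s t, .fin (.atom (ρ.subst z s))] [.fin (.atom (ρ.subst z t))]
  | irrefl (s : Term) : RelAxiom [.lt s s] []
  | trans (s t u : Term) : RelAxiom [.lt s t, .lt t u] [.lt s u]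
  | total (s t : Term) : RelAxiom [] [.lt s t, .eq s t, .lt t s]
  | least (s : Term) : RelAxiom [] [.lt .c s, .eq .c s]
  | dense (s t : Term) : RelAxiom [.lt s t]
      [.fin (.ex (.and (.atom (.lt (s.weaken 1) (.bnd 0))) (.atom (.lt (.bnd 0) (t.weaken 1)))))]
  | lt_f (s : Term) : RelAxiom [] [.lt s (.f s)]
  | mono (s t : Term) : RelAxiom [.lt s t] [.lt (.f s) (.f t)]
  | cofinal (s : Term) : RelAxiom [] [.bigOr s]

/-- The axioms different from the identity axioms: external and internal versions of the
relational axioms, and the axioms allowing to replace equal external, respectively internal,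
labels. -/
inductive IsAxiom : Sequent → Prop
  | ext {Γ Δ : List RForm} (h : RelAxiom Γ Δ) : IsAxiom (Γ.map .rel, Δ.map .rel)
  | int (T : Term) {Γ Δ : List RForm} (h : RelAxiom Γ Δ) :
      IsAxiom (Γ.map (.labR T), Δ.map (.labR T))
  | labelR (T S : Term) (ρ : Atom 0) :
      IsAxiom ([.rel (.eq T S), .labR T (.fin (.atom ρ))], [.labR S (.fin (.atom ρ))])
  | labelT (T S t : Term) (ψ : ITemp) :
      IsAxiom ([.rel (.eq T S), .labT T (.lab t ψ)], [.labT S (.lab t ψ)])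
  | labelI (T t s : Term) (p : ℕ) :
      IsAxiom ([.labR T (.eq t s), .labT T (.lab t (.prop p))], [.labT T (.lab s (.prop p))])

/-! ### The reduction tree -/

/-- The new formulas which a leaf gains: those added to the antecedent and those
added to the succedent. -/
abbrev Gain : Type := Sequent

/-- The leaves for a relational formula in the antecedent. `w` puts the external label back
(or is `Formula.rel`), `u` is the term and `x` the variable for instantiations. -/
def relLeft (w : RForm → Formula) (u : Term) (x : ℕ) : RForm → Set Gain
  | .fin (.atom _) => ∅
  | .fin (.neg φ) => {([], [w (.fin φ)])}
  | .fin (.and φ ψ) => {([w (.fin φ), w (.fin ψ)], [])}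
  | .fin (.or φ ψ) => {([w (.fin φ)], []), ([w (.fin ψ)], [])}
  | .fin (.imp φ ψ) => {([w (.fin ψ)], []), ([], [w (.fin φ)])}
  | .fin (.all φ) => {([w (.fin (φ.inst u))], [])}
  | .fin (.ex φ) => {([w (.fin (φ.inst (.var x)))], [])}
  | .bigOr t => Set.range fun i : ℕ => ([w (.lt t (Tm.iter .c i))], [])
  | .allBigOr => {([w (.bigOr u)], [])}

/-- The leaves for a relational formula in the succedent `Δ`. -/
def relRight (w : RForm → Formula) (u : Term) (x : ℕ) (Δ : List Formula) : RForm → Set Gain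
  | .fin (.atom _) => ∅
  | .fin (.neg φ) => {([w (.fin φ)], [])}
  | .fin (.and φ ψ) => {([], [w (.fin φ)]), ([], [w (.fin ψ)])}
  | .fin (.or φ ψ) => {([], [w (.fin φ), w (.fin ψ)])}
  | .fin (.imp φ ψ) => {([w (.fin φ)], [w (.fin ψ)])}
  | .fin (.all φ) => {([], [w (.fin (φ.inst (.var x)))])}
  | .fin (.ex φ) => {([], [w (.fin (φ.inst u))])}
  | .bigOr t => {e | ∃ m : ℕ, IsLeast {k : ℕ | w (.lt t (Tm.iter .c k)) ∉ Δ} m ∧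
      e = ([], [w (.lt t (Tm.iter .c m))])}
  | .allBigOr => {([], [w (.bigOr (.var x))])}

/-- The leaves for `T : t : η` in the antecedent. -/
def intLeft (T t u : Term) : ITemp → Set Gain
  | .prop _ => ∅
  | .neg η => {([], [.labT T (.lab t η)])}
  | .and η ξ => {([.labT T (.lab t η), .labT T (.lab t ξ)], [])}
  | .or η ξ => {([.labT T (.lab t η)], []), ([.labT T (.lab t ξ)], [])}
  | .imp η ξ => {([.labT T (.lab t ξ)], []), ([], [.labT T (.lab t η)])}
  | .box I η => {e | ∃ φ ∈ I.bounds t u, e = ([], [.labR T φ])} ∪ {([.labT T (.lab u η)], [])}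

/-- The leaves for `T : t : η` in the succedent. -/
def intRight (T t : Term) (x : ℕ) : ITemp → Set Gain
  | .prop _ => ∅
  | .neg η => {([.labT T (.lab t η)], [])}
  | .and η ξ => {([], [.labT T (.lab t η)]), ([], [.labT T (.lab t ξ)])}
  | .or η ξ => {([], [.labT T (.lab t η), .labT T (.lab t ξ)])}
  | .imp η ξ => {([.labT T (.lab t η)], [.labT T (.lab t ξ)])}
  | .box I η => {((I.bounds t (.var x)).map (.labR T), [.labT T (.lab (.var x) η)])}

/-- The leaves for a formula in the antecedent. -/
def leftGains (u : Term) (x : ℕ) : Formula → Set Gain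
  | .rel φ => relLeft .rel u x φ
  | .labR T φ => relLeft (.labR T) u x φ
  | .labT T (.lab t η) => intLeft T t u η
  | .labT T (.neg α) => {([], [.labT T α])}
  | .labT T (.and α β) => {([.labT T α, .labT T β], [])}
  | .labT T (.or α β) => {([.labT T α], []), ([.labT T β], [])}
  | .labT T (.imp α β) => {([.labT T β], []), ([], [.labT T α])}
  | .labT T (.box I α) => {e | ∃ φ ∈ I.bounds T u, e = ([], [.rel φ])} ∪ {([.labT u α], [])}

/-- The leaves for a formula in the succedent `Δ`. -/
def rightGains (u : Term) (x : ℕ) (Δ : List Formula) : Formula → Set Gain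
  | .rel φ => relRight .rel u x Δ φ
  | .labR T φ => relRight (.labR T) u x Δ φ
  | .labT T (.lab t η) => intRight T t x η
  | .labT T (.neg α) => {([.labT T α], [])}
  | .labT T (.and α β) => {([], [.labT T α]), ([], [.labT T β])}
  | .labT T (.or α β) => {([], [.labT T α, .labT T β])}
  | .labT T (.imp α β) => {([.labT T α], [.labT T β])}
  | .labT T (.box I α) => {((I.bounds T (.var x)).map .rel, [.labT (.var x) α])}

/-- A node of the reduction tree: a sequent `Γ ⊢ Δ`, the ordering of its formulas, the number
`idx` of axioms examined so far on the branch, and a record `used` of the terms already used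
on the branch for each formula. -/
structure Node where
  Γ : List Formula
  Δ : List Formula
  ord : List Formula
  idx : ℕ
  used : List (Formula × Term)

/-- The sequent of the node follows from an axiom (possibly an identity axiom `A ⊢ A`) by
structural rules, i.e. weakening, exchange and contraction. -/
def Node.Closed (ν : Node) : Prop :=
  (∃ A, A ∈ ν.Γ ∧ A ∈ ν.Δ) ∨ ∃ s : Sequent, IsAxiom s ∧ s.1 ⊆ ν.Γ ∧ s.2 ⊆ ν.Δ

/-- The choices on which the construction of the tree depends: enumerations of the axioms
(with infinite repetition) and of the internal and external terms, and the choice, at each node,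
of internal and external variables not free in its sequent. A node is given with the path
leading to it, latest node first. -/
structure ReductionData where
  ax : ℕ → Sequent
  ax_isAxiom : ∀ n, IsAxiom (ax n)
  ax_repeats : ∀ s, IsAxiom s → ∀ n, ∃ m, n ≤ m ∧ ax m = s
  termI : ℕ → Term
  termI_surj : Function.Surjective termI
  termE : ℕ → Term
  termE_surj : Function.Surjective termE
  varI : List Node → ℕ
  varI_fresh : ∀ (ν : Node) (p : List Node) (A : Formula), A ∈ ν.Γ ∨ A ∈ ν.Δ →
    ¬ A.OccursI (varI (ν :: p))
  varE : List Node → ℕ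
  varE_fresh : ∀ (ν : Node) (p : List Node) (A : Formula), A ∈ ν.Γ ∨ A ∈ ν.Δ →
    ¬ A.OccursE (varE (ν :: p))

def ReductionData.terms (D : ReductionData) (A : Formula) : ℕ → Term :=
  if A.isExternal then D.termE else D.termI

def ReductionData.variable (D : ReductionData) (A : Formula) : List Node → ℕ :=
  if A.isExternal then D.varE else D.varI

/-- `u` is the first term of the enumeration not yet used for `A`. -/
def FirstUnused (terms : ℕ → Term) (used : List (Formula × Term)) (A : Formula) (u : Term) : Prop :=
  ∃ i, terms i = u ∧ (A, u) ∉ used ∧ ∀ j < i, (A, terms j) ∈ used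

/-- Extension of `ν` by the next axiom `B₁,…,Bₖ ⊢ D₁,…,Dₘ` of the enumeration: if all `Bᵢ` occur
in the antecedent there is one child for each `Dᵢ`, which is added to the antecedent; otherwise
the sequent stays and is only reordered. The new ordering is `rest` followed by `Dᵢ`, if any, and
then `last`. -/
def AxiomChild (D : ReductionData) (ν : Node) (rest last : List Formula) (ν' : Node) : Prop :=
  ((D.ax ν.idx).1 ⊆ ν.Γ ∧ ∃ E ∈ (D.ax ν.idx).2,
      ν' = ⟨ν.Γ ++ [E], ν.Δ, rest ++ [E] ++ last, ν.idx + 1, ν.used⟩) ∨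
  (¬ (D.ax ν.idx).1 ⊆ ν.Γ ∧ ν' = ⟨ν.Γ, ν.Δ, rest ++ last, ν.idx + 1, ν.used⟩)

/-- Extension of the last node `ν` of a path by the logical rule for the first formula `A` in its
ordering. -/
def LogicalChild (D : ReductionData) (ν : Node) (p : List Node) (A : Formula)
    (rest : List Formula) (ν' : Node) : Prop :=
  ∃ u, FirstUnused (D.terms A) ν.used A u ∧ ∃ e : Gain,
    ((A ∈ ν.Γ ∧ e ∈ leftGains u (D.variable A (ν :: p)) A) ∨
      (A ∈ ν.Δ ∧ e ∈ rightGains u (D.variable A (ν :: p)) ν.Δ A)) ∧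
    ν' = ⟨ν.Γ ++ e.1, ν.Δ ++ e.2, rest ++ e.1 ++ e.2 ++ [A], ν.idx, (A, u) :: ν.used⟩

/-- `ν'` is a child of the node reached by the path (latest node first). -/
def Child (D : ReductionData) : List Node → Node → Prop
  | [], _ => False
  | ν :: p, ν' => ¬ ν.Closed ∧
      match ν.ord with
      | [] => AxiomChild D ν [] [] ν'
      | A :: rest => (A.IsAtomic ∧ AxiomChild D ν rest [A] ν') ∨
          (¬ A.IsAtomic ∧ LogicalChild D ν p A rest ν')

/-- The finite approximations of the reduction tree of `Γ ⊢ Δ` with initial ordering `ord`, as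
sets of finite paths from the root, latest node first. -/
def treeStage (D : ReductionData) (Γ Δ ord : List Formula) : ℕ → Set (List Node)
  | 0 => {[⟨Γ, Δ, ord, 0, []⟩]}
  | n + 1 => treeStage D Γ Δ ord n ∪
      {q | ∃ p ∈ treeStage D Γ Δ ord n, ∃ ν', Child D p ν' ∧ q = ν' :: p}

/-- The reduction tree. -/
def reductionTree (D : ReductionData) (Γ Δ ord : List Formula) : Set (List Node) :=
  ⋃ n, treeStage D Γ Δ ord n

/-- The initial segment `b n, …, b 0` of a sequence of nodes. -/
def initialPath (b : ℕ → Node) : ℕ → List Node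
  | 0 => [b 0]
  | n + 1 => b (n + 1) :: initialPath b n

def IsInfiniteBranch (T : Set (List Node)) (b : ℕ → Node) : Prop :=
  ∀ n, initialPath b n ∈ T

/-- The union of the antecedents along a branch. -/
def antecedents (b : ℕ → Node) : Set Formula := {A | ∃ n, A ∈ (b n).Γ}

/-- The union of the succedents along a branch. -/
def succedents (b : ℕ → Node) : Set Formula := {A | ∃ n, A ∈ (b n).Δ}

/-! ### The term model of a set of formulas -/

section TermModel

variable (G : Set Formula)

def EqE (S T : Term) : Prop := Formula.rel (.eq S T) ∈ G
def LtE (S T : Term) : Prop := Formula.rel (.lt S T) ∈ G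
def EqI (S t u : Term) : Prop := Formula.labR S (.eq t u) ∈ G
def LtI (S t u : Term) : Prop := Formula.labR S (.lt t u) ∈ G
def PropI (S : Term) (p : ℕ) (t : Term) : Prop := Formula.labT S (.lab t (.prop p)) ∈ G

/-- Everything needed for the term model to be well defined: the provable equalities are
equivalence relations, respected by the other symbols, and the internal data only depend on the
class of the external label. -/
structure WellDefined : Prop where
  equivE : Equivalence (EqE G)
  congF : ∀ S T, EqE G S T → EqE G (.f S) (.f T)
  congLtE : ∀ S S' T T', EqE G S S' → EqE G T T' → LtE G S T → LtE G S' T'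
  equivI : ∀ S, Equivalence (EqI G S)
  congf : ∀ S t u, EqI G S t u → EqI G S (.f t) (.f u)
  congLtI : ∀ S t t' u u', EqI G S t t' → EqI G S u u' → LtI G S t u → LtI G S t' u'
  congProp : ∀ S p t u, EqI G S t u → PropI G S p t → PropI G S p u
  labelEq : ∀ S T t u, EqE G S T → EqI G S t u → EqI G T t u
  labelLt : ∀ S T t u, EqE G S T → LtI G S t u → LtI G T t u
  labelProp : ∀ S T p t, EqE G S T → PropI G S p t → PropI G T p t

variable {G}

def setoidE (h : WellDefined G) : Setoid Term := ⟨EqE G, h.equivE⟩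

/-- The external term flow: `T^∼ < S^∼` iff `T < S` is in `G`. -/
def flowE (h : WellDefined G) : Flow (Quotient (setoidE h)) where
  lt := Quotient.lift₂ (s₁ := setoidE h) (s₂ := setoidE h) (LtE G) fun S T S' T' hS hT =>
    propext ⟨h.congLtE S S' T T' hS hT,
      h.congLtE S' S T' T (h.equivE.symm hS) (h.equivE.symm hT)⟩
  zero := Quotient.mk (setoidE h) .c
  g := Quotient.map' (s₁ := setoidE h) (s₂ := setoidE h) Tm.f fun S T hST => h.congF S T hST

/-- The relation `∼ₐ` on internal terms, for `a = S^∼`, is `∼_S`. -/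
def setoidI (h : WellDefined G) (a : Quotient (setoidE h)) : Setoid Term where
  r t u := ∃ S, Quotient.mk (setoidE h) S = a ∧ EqI G S t u
  iseqv :=
    { refl := fun t => by
        obtain ⟨S, hS⟩ := Quotient.exists_rep a
        exact ⟨S, hS, (h.equivI S).refl t⟩
      symm := by
        rintro t u ⟨S, hS, e⟩
        exact ⟨S, hS, (h.equivI S).symm e⟩
      trans := by
        rintro t u v ⟨S, hS, e⟩ ⟨T, hT, e'⟩
        have hTS : EqE G T S := Quotient.exact (s := setoidE h) (hT.trans hS.symm)
        exact ⟨S, hS, (h.equivI S).trans e (h.labelEq T S _ _ hTS e')⟩ }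

/-- The internal term flow at `a = S^∼`: `t^S < u^S` iff `S : t < u` is in `G`. -/
def flowN (h : WellDefined G) (a : Quotient (setoidE h)) : Flow (Quotient (setoidI h a)) where
  lt x y := ∃ S t u, Quotient.mk (setoidE h) S = a ∧ Quotient.mk (setoidI h a) t = x ∧
    Quotient.mk (setoidI h a) u = y ∧ LtI G S t u
  zero := Quotient.mk (setoidI h a) .c
  g := Quotient.map' (s₁ := setoidI h a) (s₂ := setoidI h a) Tm.f
    fun t u ⟨S, hS, e⟩ => ⟨S, hS, h.congf S t u e⟩

/-- The term model. -/
def termModel (h : WellDefined G) : Interp where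
  M := Quotient (setoidE h)
  flow := flowE h
  N a := Quotient (setoidI h a)
  flowI a := flowN h a
  val a p := {x | ∃ S t, Quotient.mk (setoidE h) S = a ∧ Quotient.mk (setoidI h a) t = x ∧
    PropI G S p t}
  σ X := Quotient.mk (setoidE h) (.var X)
  σI a x := Quotient.mk (setoidI h a) (.var x)

end TermModel

end MTL2

namespace MTL2

/-! ### Syntax: substitution and size -/

/-! An infinite branch is a fair search for a countermodel, and the term model read off from its
limit is such a countermodel.

Fairness. The ordering of a node is a queue: its head is treated and then moved behind everything
else, new formulas included, so each formula of the ordering returns to the head again and again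
(`exists_head`). A non-atomic head has its rule applied with the first term not yet used for it,
hence in the long run with every term (`exists_usesAt`). Axioms are examined only when the head is
atomic or the ordering is empty. This keeps happening, since every rule adds a formula of smaller
size and the descent ends at an atomic one (`exists_atomic`). As every axiom recurs in the
enumeration, an axiom whose antecedent lies on the left of the limit contributes a formula of its
succedent (`axiom_mem`). Both sides only grow and no node is closed, so the two sides are disjoint.
`Saturated` collects these properties, and from there on the tree is not needed.

Model. The axioms for equality and for replacing labels make the term model well defined
(`Saturated.wellDefined`). The external flow and each internal flow are then treated by one
argument: every element is the value of a term, and an atomic relational formula is true iff it lies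
on the left (`Realizes`). `Realizes.truth` extends this to all relational formulas, and
`Realizes.isTimeFlow` turns the extralogical axioms into the properties of a time flow. Temporal
formulas follow by induction, first inside one internal flow (`truth_lab`), then over the external
flow (`truth_labT`). -/

/-- A bound for the free variables of a term. -/
def Tm.varBound : Term → ℕ
  | .var x => x + 1
  | .c => 0
  | .f t => Tm.varBound t

theorem Tm.subst_of_varBound_le {z : ℕ} {u : Term} :
    (t : Term) → Tm.varBound t ≤ z → Tm.subst z u t = t
  | .var x, h => by
      have : x ≠ z := by simp only [Tm.varBound] at h; omega
      simp [Tm.subst, this]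
  | .c, _ => rfl
  | .f t, h => by
      have := Tm.subst_of_varBound_le (u := u) t h
      simp [Tm.subst, this]

theorem Tm.inst_weaken (u : Term) : (t : Term) → Tm.inst u (Tm.weaken 1 t) = t
  | .var _ => rfl
  | .c => rfl
  | .f t => by simp [Tm.weaken, Tm.inst, Tm.inst_weaken u t]

theorem Tm.inst_bnd_zero (u : Term) : Tm.inst (k := 0) u (.bnd 0) = u := by
  have h : (t : Term) → Tm.weaken 0 t = t := by
    -- The induction principle of `Tm.varBound` is induction on terms of `Tm 0` without the vacuous
    -- case of a bound variable.
    intro t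
    induction t using Tm.varBound.induct with
    | case1 x => rfl
    | case2 => rfl
    | case3 t ih => simp [Tm.weaken, ih]
  simp [Tm.inst, h]

/-! ### A size that decreases along the logical rules -/

/-- Number of logical symbols. -/
def FinForm.size : {k : ℕ} → FinForm k → ℕ
  | _, .atom _ => 0
  | _, .neg φ => φ.size + 1
  | _, .and φ ψ => φ.size + ψ.size + 1
  | _, .or φ ψ => φ.size + ψ.size + 1
  | _, .imp φ ψ => φ.size + ψ.size + 1
  | _, .all φ => φ.size + 1
  | _, .ex φ => φ.size + 1

theorem FinForm.size_inst (u : Term) : {k : ℕ} → (φ : FinForm (k + 1)) → (φ.inst u).size = φ.size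
  | _, .atom _ => by simp [FinForm.inst, FinForm.size]
  | _, .neg φ => by simp [FinForm.inst, FinForm.size, FinForm.size_inst u φ]
  | _, .and φ ψ => by
      simp [FinForm.inst, FinForm.size, FinForm.size_inst u φ, FinForm.size_inst u ψ]
  | _, .or φ ψ => by
      simp [FinForm.inst, FinForm.size, FinForm.size_inst u φ, FinForm.size_inst u ψ]
  | _, .imp φ ψ => by
      simp [FinForm.inst, FinForm.size, FinForm.size_inst u φ, FinForm.size_inst u ψ]
  | _, .all φ => by simp [FinForm.inst, FinForm.size, FinForm.size_inst u φ]
  | _, .ex φ => by simp [FinForm.inst, FinForm.size, FinForm.size_inst u φ]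

/-- The weights 2 and 1 make the quantified disjunction heavier than its instances, and these
heavier than atoms. -/
def RForm.size : RForm → ℕ
  | .fin φ => φ.size
  | .bigOr _ => 1
  | .allBigOr => 2

/-- A box counts 2 because the bounds that its rules introduce can be disjunctions `s ≤ t`, of size
1. `ETemp.size` follows the same convention. -/
def ITemp.size : ITemp → ℕ
  | .prop _ => 0
  | .neg η => η.size + 1
  | .and η ξ => η.size + ξ.size + 1
  | .or η ξ => η.size + ξ.size + 1
  | .imp η ξ => η.size + ξ.size + 1
  | .box _ η => η.size + 2

def ETemp.size : ETemp → ℕ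
  | .lab _ ψ => ψ.size
  | .neg α => α.size + 1
  | .and α β => α.size + β.size + 1
  | .or α β => α.size + β.size + 1
  | .imp α β => α.size + β.size + 1
  | .box _ α => α.size + 2

def Formula.size : Formula → ℕ
  | .rel φ => φ.size
  | .labR _ φ => φ.size
  | .labT _ β => β.size

theorem lowerBound_size (c : Bool) (m : ℕ) (t s : Term) : (lowerBound c m t s).size ≤ 1 := by
  cases c <;> simp [lowerBound, RForm.size, FinForm.size]

theorem upperBound_size (c : Bool) (m : ℕ) (t s : Term) : (upperBound c m t s).size ≤ 1 := by
  cases c <;> simp [upperBound, RForm.size, FinForm.size]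

theorem Ivl.bounds_size (I : Ivl) (t s : Term) (φ : RForm) (h : φ ∈ I.bounds t s) :
    φ.size ≤ 1 := by
  cases I <;> simp only [Ivl.bounds, List.mem_cons, List.not_mem_nil, or_false] at h
  · rcases h with rfl | rfl
    · exact lowerBound_size ..
    · exact upperBound_size ..
  · subst h; exact lowerBound_size ..

theorem relLeft_size {w : RForm → Formula} (hw : ∀ φ, (w φ).size = φ.size) {u : Term} {x : ℕ}
    {φ : RForm} {e : Gain} (he : e ∈ relLeft w u x φ) :
    ∃ B ∈ e.1 ++ e.2, B.size < φ.size := by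
  rcases φ with φ | t | _
  · cases φ <;> simp only [relLeft, Set.mem_empty_iff_false, Set.mem_insert_iff,
      Set.mem_singleton_iff] at he
    all_goals first
      | (subst he; simp [hw, RForm.size, FinForm.size, FinForm.size_inst])
      | (rcases he with rfl | rfl <;> simp [hw, RForm.size, FinForm.size])
  · obtain ⟨i, rfl⟩ := he
    simp [hw, RForm.size, FinForm.size]
  · simp only [relLeft, Set.mem_singleton_iff] at he
    subst he; simp [hw, RForm.size]

theorem relRight_size {w : RForm → Formula} (hw : ∀ φ, (w φ).size = φ.size) {u : Term} {x : ℕ}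
    {Δ : List Formula} {φ : RForm} {e : Gain} (he : e ∈ relRight w u x Δ φ) :
    ∃ B ∈ e.1 ++ e.2, B.size < φ.size := by
  rcases φ with φ | t | _
  · cases φ <;> simp only [relRight, Set.mem_empty_iff_false, Set.mem_insert_iff,
      Set.mem_singleton_iff] at he
    all_goals first
      | (subst he; simp [hw, RForm.size, FinForm.size, FinForm.size_inst])
      | (rcases he with rfl | rfl <;> simp [hw, RForm.size, FinForm.size])
  · obtain ⟨i, _, rfl⟩ := he
    simp [hw, RForm.size, FinForm.size]
  · simp only [relRight, Set.mem_singleton_iff] at he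
    subst he; simp [hw, RForm.size]

/-- One smaller formula per gain is all that the descent in `exists_atomic` needs; in particular no
gain is empty. -/
theorem leftGains_size {u : Term} {x : ℕ} {A : Formula} {e : Gain} (he : e ∈ leftGains u x A) :
    ∃ B ∈ e.1 ++ e.2, B.size < A.size := by
  rcases A with φ | ⟨T, φ⟩ | ⟨T, β⟩
  · exact relLeft_size (w := .rel) (fun _ => rfl) he
  · exact relLeft_size (w := .labR T) (fun _ => rfl) he
  · rcases β with ⟨t, η⟩ | α | ⟨α, β⟩ | ⟨α, β⟩ | ⟨α, β⟩ | ⟨I, α⟩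
    · cases η <;> simp only [leftGains, intLeft, Set.mem_empty_iff_false, Set.mem_insert_iff,
        Set.mem_singleton_iff, Set.mem_union, Set.mem_ofPred_eq] at he
      case box I η =>
        rcases he with ⟨φ, hφ, rfl⟩ | rfl
        · have := I.bounds_size _ _ _ hφ
          simp [Formula.size, ETemp.size, ITemp.size]; omega
        · simp [Formula.size, ETemp.size, ITemp.size]
      all_goals first
        | (subst he; simp [Formula.size, ETemp.size, ITemp.size])
        | (rcases he with rfl | rfl <;> simp [Formula.size, ETemp.size, ITemp.size])
    all_goals simp only [leftGains, Set.mem_insert_iff,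
        Set.mem_singleton_iff, Set.mem_union, Set.mem_ofPred_eq] at he
    case box =>
      rcases he with ⟨φ, hφ, rfl⟩ | rfl
      · have := I.bounds_size _ _ _ hφ
        simp [Formula.size, ETemp.size]; omega
      · simp [Formula.size, ETemp.size]
    all_goals first
      | (subst he; simp [Formula.size, ETemp.size])
      | (rcases he with rfl | rfl <;> simp [Formula.size, ETemp.size])

theorem rightGains_size {u : Term} {x : ℕ} {Δ : List Formula} {A : Formula} {e : Gain}
    (he : e ∈ rightGains u x Δ A) : ∃ B ∈ e.1 ++ e.2, B.size < A.size := by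
  rcases A with φ | ⟨T, φ⟩ | ⟨T, β⟩
  · exact relRight_size (w := .rel) (fun _ => rfl) he
  · exact relRight_size (w := .labR T) (fun _ => rfl) he
  · rcases β with ⟨t, η⟩ | α | ⟨α, β⟩ | ⟨α, β⟩ | ⟨α, β⟩ | ⟨I, α⟩
    · cases η <;> simp only [rightGains, intRight, Set.mem_empty_iff_false, Set.mem_insert_iff,
        Set.mem_singleton_iff] at he
      case box I η =>
        subst he
        exact ⟨.labT T (.lab (.var x) η), by simp, by simp [Formula.size, ETemp.size, ITemp.size]⟩
      all_goals first
        | (subst he; simp [Formula.size, ETemp.size, ITemp.size])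
        | (rcases he with rfl | rfl <;> simp [Formula.size, ETemp.size, ITemp.size])
    all_goals simp only [rightGains, Set.mem_insert_iff, Set.mem_singleton_iff] at he
    case box =>
      subst he
      exact ⟨.labT (.var x) α, by simp, by simp [Formula.size, ETemp.size]⟩
    all_goals first
      | (subst he; simp [Formula.size, ETemp.size])
      | (rcases he with rfl | rfl <;> simp [Formula.size, ETemp.size])

/-! ### Infinite branches -/

/-- The `n`-th step of the branch examines an axiom. -/
def AxStep (D : ReductionData) (b : ℕ → Node) (n : ℕ) : Prop :=
  ∃ rest last, (b n).ord = last ++ rest ∧ AxiomChild D (b n) rest last (b (n + 1))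

/-- The `n`-th step of the branch applies the logical rule for `A`. -/
def LogStep (D : ReductionData) (b : ℕ → Node) (n : ℕ) (A : Formula) : Prop :=
  ∃ p rest, (b n).ord = A :: rest ∧ LogicalChild D (b n) p A rest (b (n + 1))

theorem initialPath_ne_nil (b : ℕ → Node) (n : ℕ) : initialPath b n ≠ [] := by
  cases n <;> simp [initialPath]

theorem initialPath_eq_cons (b : ℕ → Node) (n : ℕ) : ∃ p, initialPath b n = b n :: p := by
  cases n <;> simp [initialPath]

/-- The empty path has no children, so a path of length one can only be the root and any longer path
ends in a child of its predecessor. This recovers the root and the successor relation from an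
infinite branch. -/
theorem treeStage_cases {D : ReductionData} {Γ Δ ord : List Formula} {q : List Node} (n : ℕ)
    (hq : q ∈ treeStage D Γ Δ ord n) :
    q = [⟨Γ, Δ, ord, 0, []⟩] ∨ ∃ p ν', p ≠ [] ∧ Child D p ν' ∧ q = ν' :: p := by
  induction n with
  | zero => exact Or.inl hq
  | succ n ih =>
    rcases hq with hq | ⟨p, -, ν', hc, rfl⟩
    · exact ih hq
    · refine Or.inr ⟨p, ν', ?_, hc, rfl⟩
      rintro rfl
      exact hc

section Branch

variable {D : ReductionData} {Γ Δ ord : List Formula} {b : ℕ → Node}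

theorem IsInfiniteBranch.root (hb : IsInfiniteBranch (reductionTree D Γ Δ ord) b) :
    b 0 = ⟨Γ, Δ, ord, 0, []⟩ := by
  obtain ⟨n, hn⟩ := Set.mem_iUnion.1 (hb 0)
  rcases treeStage_cases n hn with h | ⟨p, ν', hp, -, h⟩
  · simpa [initialPath] using h
  · simp only [initialPath, List.cons.injEq] at h
    exact absurd h.2.symm hp

theorem IsInfiniteBranch.child (hb : IsInfiniteBranch (reductionTree D Γ Δ ord) b) (n : ℕ) :
    Child D (initialPath b n) (b (n + 1)) := by
  obtain ⟨m, hm⟩ := Set.mem_iUnion.1 (hb (n + 1))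
  rcases treeStage_cases m hm with h | ⟨p, ν', hp, hc, h⟩
  · simp only [initialPath, List.cons.injEq] at h
    exact absurd h.2 (initialPath_ne_nil b n)
  · simp only [initialPath, List.cons.injEq] at h
    rw [h.1, h.2]
    exact hc

theorem IsInfiniteBranch.not_closed (hb : IsInfiniteBranch (reductionTree D Γ Δ ord) b) (n : ℕ) :
    ¬ (b n).Closed := by
  have h := hb.child n
  obtain ⟨p, hp⟩ := initialPath_eq_cons b n
  rw [hp] at h
  exact h.1

theorem IsInfiniteBranch.axStep_of_nil (hb : IsInfiniteBranch (reductionTree D Γ Δ ord) b) {n : ℕ}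
    (hn : (b n).ord = []) : AxStep D b n := by
  have h := hb.child n
  obtain ⟨p, hp⟩ := initialPath_eq_cons b n
  rw [hp] at h
  simp only [Child, hn] at h
  exact ⟨[], [], by simp [hn], h.2⟩

theorem IsInfiniteBranch.axStep_of_cons (hb : IsInfiniteBranch (reductionTree D Γ Δ ord) b) {n : ℕ}
    {A : Formula} {rest : List Formula} (hn : (b n).ord = A :: rest) (hA : A.IsAtomic) :
    AxStep D b n := by
  have h := hb.child n
  obtain ⟨p, hp⟩ := initialPath_eq_cons b n
  rw [hp] at h
  simp only [Child, hn] at h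
  rcases h.2 with h | h
  · exact ⟨rest, [A], by simp [hn], h.2⟩
  · exact absurd hA h.1

theorem IsInfiniteBranch.logStep_of_cons (hb : IsInfiniteBranch (reductionTree D Γ Δ ord) b) {n : ℕ}
    {A : Formula} {rest : List Formula} (hn : (b n).ord = A :: rest) (hA : ¬ A.IsAtomic) :
    LogStep D b n A := by
  have h := hb.child n
  obtain ⟨p, hp⟩ := initialPath_eq_cons b n
  rw [hp] at h
  simp only [Child, hn] at h
  rcases h.2 with h | h
  · exact absurd h.1 hA
  · exact ⟨p, rest, hn, h.2⟩

theorem IsInfiniteBranch.step (hb : IsInfiniteBranch (reductionTree D Γ Δ ord) b) (n : ℕ) :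
    AxStep D b n ∨ ∃ A, LogStep D b n A := by
  rcases hn : (b n).ord with _ | ⟨A, rest⟩
  · exact Or.inl (hb.axStep_of_nil hn)
  · by_cases hA : A.IsAtomic
    · exact Or.inl (hb.axStep_of_cons hn hA)
    · exact Or.inr ⟨A, hb.logStep_of_cons hn hA⟩

/-- How one step changes the sequent and its ordering. -/
theorem IsInfiniteBranch.exists_gain (hb : IsInfiniteBranch (reductionTree D Γ Δ ord) b) (n : ℕ) :
    ∃ e : Gain, (b (n + 1)).Γ = (b n).Γ ++ e.1 ∧ (b (n + 1)).Δ = (b n).Δ ++ e.2 ∧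
      (b (n + 1)).ord = (b n).ord.tail ++ e.1 ++ e.2 ++ (b n).ord.take 1 := by
  have h := hb.child n
  obtain ⟨p, hp⟩ := initialPath_eq_cons b n
  -- With `tail` and `take 1`, the empty ordering and the ordering with an atomic head become a
  -- single case.
  have key : AxiomChild D (b n) (b n).ord.tail ((b n).ord.take 1) (b (n + 1)) → ∃ e : Gain,
      (b (n + 1)).Γ = (b n).Γ ++ e.1 ∧ (b (n + 1)).Δ = (b n).Δ ++ e.2 ∧
      (b (n + 1)).ord = (b n).ord.tail ++ e.1 ++ e.2 ++ (b n).ord.take 1 := by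
    rintro (⟨-, E, -, h⟩ | ⟨-, h⟩)
    · exact ⟨([E], []), by simp [h]⟩
    · exact ⟨([], []), by simp [h]⟩
  rw [hp] at h
  rcases hn : (b n).ord with _ | ⟨A, rest⟩
  · simp only [Child, hn] at h
    simp only [hn] at key
    exact key h.2
  · simp only [Child, hn] at h
    simp only [hn] at key
    rcases h.2 with h | ⟨-, u, -, e, -, h⟩
    · exact key h.2
    · exact ⟨e, by simp [h]⟩

theorem IsInfiniteBranch.Γ_mono (hb : IsInfiniteBranch (reductionTree D Γ Δ ord) b) {m n : ℕ}
    (h : m ≤ n) : (b m).Γ ⊆ (b n).Γ := by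
  induction n, h using Nat.le_induction with
  | base => simp
  | succ n _ ih =>
    obtain ⟨e, h, -⟩ := hb.exists_gain n
    rw [h]
    exact fun A hA => List.mem_append_left _ (ih hA)

theorem IsInfiniteBranch.Δ_mono (hb : IsInfiniteBranch (reductionTree D Γ Δ ord) b) {m n : ℕ}
    (h : m ≤ n) : (b m).Δ ⊆ (b n).Δ := by
  induction n, h using Nat.le_induction with
  | base => simp
  | succ n _ ih =>
    obtain ⟨e, -, h, -⟩ := hb.exists_gain n
    rw [h]
    exact fun A hA => List.mem_append_left _ (ih hA)

theorem IsInfiniteBranch.ord_mono (hb : IsInfiniteBranch (reductionTree D Γ Δ ord) b) {m n : ℕ}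
    (h : m ≤ n) : (b m).ord ⊆ (b n).ord := by
  induction n, h using Nat.le_induction with
  | base => simp
  | succ n _ ih =>
    obtain ⟨e, -, -, h'⟩ := hb.exists_gain n
    intro A hA
    have := ih hA
    rw [← List.take_append_drop 1 (b n).ord, List.drop_one] at this
    rw [h']
    simp only [List.mem_append] at this ⊢
    tauto

theorem IsInfiniteBranch.mem_ord (hb : IsInfiniteBranch (reductionTree D Γ Δ ord) b)
    (hord : ∀ A, A ∈ Γ ∨ A ∈ Δ → A ∈ ord) (n : ℕ) {A : Formula}
    (hA : A ∈ (b n).Γ ∨ A ∈ (b n).Δ) : A ∈ (b n).ord := by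
  induction n with
  | zero => rw [hb.root] at hA ⊢; exact hord A hA
  | succ n ih =>
    obtain ⟨e, h1, h2, h3⟩ := hb.exists_gain n
    rw [← List.take_append_drop 1 (b n).ord, List.drop_one] at ih
    rw [h1, h2] at hA
    rw [h3]
    simp only [List.mem_append] at hA ih ⊢
    tauto

/-- Every formula of the ordering comes to its head again and again. -/
theorem IsInfiniteBranch.exists_head (hb : IsInfiniteBranch (reductionTree D Γ Δ ord) b) {n : ℕ}
    {A : Formula} (hA : A ∈ (b n).ord) : ∃ m, n ≤ m ∧ ∃ rest, (b m).ord = A :: rest := by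
  obtain ⟨l, l', h⟩ := List.append_of_mem hA
  clear hA
  induction l generalizing n l' with
  | nil => exact ⟨n, le_rfl, l', h⟩
  | cons B l ih =>
    obtain ⟨e, -, -, h'⟩ := hb.exists_gain n
    -- The head `B` and the new formulas all go behind `A`, so one formula fewer precedes it.
    obtain ⟨m, hm, r⟩ := ih (n := n + 1) (l' := l' ++ e.1 ++ e.2 ++ [B]) (by simp [h', h])
    exact ⟨m, by omega, r⟩

/-- Descent on size: when a non-atomic formula reaches the head, its rule puts a smaller formula
into the ordering. -/
theorem IsInfiniteBranch.exists_atomic (hb : IsInfiniteBranch (reductionTree D Γ Δ ord) b) {n : ℕ}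
    {A : Formula} (hA : A ∈ (b n).ord) : ∃ m, n ≤ m ∧ ∃ B ∈ (b m).ord, B.IsAtomic := by
  induction hk : A.size using Nat.strong_induction_on generalizing n A with
  | _ k ih =>
    obtain ⟨m, hm, rest, hr⟩ := hb.exists_head hA
    by_cases hat : A.IsAtomic
    · exact ⟨m, hm, A, by simp [hr], hat⟩
    · obtain ⟨p, rest, -, u, -, e, he, h⟩ := hb.logStep_of_cons hr hat
      have : ∃ B ∈ e.1 ++ e.2, B.size < A.size := by
        rcases he with ⟨-, he⟩ | ⟨-, he⟩
        · exact leftGains_size he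
        · exact rightGains_size he
      obtain ⟨B, hB, hlt⟩ := this
      have hB' : B ∈ (b (m + 1)).ord := by
        rw [h]
        simp only [List.mem_append] at hB ⊢
        tauto
      obtain ⟨m', hm', r⟩ := ih _ (hk ▸ hlt) hB' rfl
      exact ⟨m', by omega, r⟩

theorem IsInfiniteBranch.exists_axStep (hb : IsInfiniteBranch (reductionTree D Γ Δ ord) b)
    (n : ℕ) : ∃ m, n ≤ m ∧ AxStep D b m := by
  rcases hn : (b n).ord with _ | ⟨A, rest⟩
  · exact ⟨n, le_rfl, hb.axStep_of_nil hn⟩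
  · obtain ⟨m, hm, B, hB, hat⟩ := hb.exists_atomic (n := n) (A := A) (by simp [hn])
    obtain ⟨m', hm', rest, hr⟩ := hb.exists_head hB
    exact ⟨m', by omega, hb.axStep_of_cons hr hat⟩

theorem AxStep.idx {n : ℕ} (h : AxStep D b n) : (b (n + 1)).idx = (b n).idx + 1 := by
  obtain ⟨rest, last, -, ⟨-, E, -, h⟩ | ⟨-, h⟩⟩ := h <;> simp [h]

theorem LogStep.idx {n : ℕ} {A : Formula} (h : LogStep D b n A) :
    (b (n + 1)).idx = (b n).idx := by
  obtain ⟨p, rest, -, u, -, e, -, h⟩ := h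
  simp [h]

theorem AxStep.used {n : ℕ} (h : AxStep D b n) : (b (n + 1)).used = (b n).used := by
  obtain ⟨rest, last, -, ⟨-, E, -, h⟩ | ⟨-, h⟩⟩ := h <;> simp [h]

/-- Every axiom of the enumeration not examined so far is examined later. -/
theorem IsInfiniteBranch.exists_axStep_idx (hb : IsInfiniteBranch (reductionTree D Γ Δ ord) b)
    (n d : ℕ) : ∃ m, n ≤ m ∧ AxStep D b m ∧ (b m).idx = (b n).idx + d := by
  -- The first axiom step from `n` on: all steps before it are logical and leave the counter
  -- unchanged. The induction is on the distance `j` to some known axiom step.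
  have next : ∀ n, ∃ m, n ≤ m ∧ AxStep D b m ∧ (b m).idx = (b n).idx := by
    intro n
    obtain ⟨m, hm, hax⟩ := hb.exists_axStep n
    obtain ⟨j, rfl⟩ := Nat.exists_eq_add_of_le hm
    clear hm
    induction j generalizing n with
    | zero => exact ⟨n, le_rfl, hax, rfl⟩
    | succ j ih =>
      rcases hb.step n with h | ⟨A, h⟩
      · exact ⟨n, le_rfl, h, rfl⟩
      · obtain ⟨m, hm, h1, h2⟩ := ih (n + 1) (by rwa [show n + 1 + j = n + (j + 1) by omega])
        exact ⟨m, by omega, h1, h2.trans h.idx⟩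
  induction d with
  | zero => exact next n
  | succ d ih =>
    obtain ⟨m, hm, h1, h2⟩ := ih
    obtain ⟨m', hm', h3, h4⟩ := next (m + 1)
    exact ⟨m', by omega, h3, by rw [h4, h1.idx, h2]; rfl⟩

theorem IsInfiniteBranch.exists_forall_mem (hb : IsInfiniteBranch (reductionTree D Γ Δ ord) b)
    (l : List Formula) (hl : ∀ A ∈ l, A ∈ antecedents b) : ∃ n, l ⊆ (b n).Γ := by
  induction l with
  | nil => exact ⟨0, by simp⟩
  | cons A l ih =>
    obtain ⟨n, hn⟩ := ih fun B hB => hl B (List.mem_cons_of_mem _ hB)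
    obtain ⟨m, hm⟩ := hl A List.mem_cons_self
    refine ⟨max n m, List.cons_subset.2 ⟨hb.Γ_mono (le_max_right _ _) hm, ?_⟩⟩
    exact fun B hB => hb.Γ_mono (le_max_left _ _) (hn hB)

/-- The finitely many antecedent formulas lie together in one node, and the axiom has an occurrence
in the enumeration that is examined at or after that node. An empty succedent would leave no child
there, so for such an axiom the conclusion is a contradiction. -/
theorem IsInfiniteBranch.axiom_mem (hb : IsInfiniteBranch (reductionTree D Γ Δ ord) b)
    {s : Sequent} (hs : IsAxiom s) (h : ∀ A ∈ s.1, A ∈ antecedents b) :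
    ∃ E ∈ s.2, E ∈ antecedents b := by
  obtain ⟨n, hn⟩ := hb.exists_forall_mem s.1 h
  obtain ⟨i, hi, rfl⟩ := D.ax_repeats s hs (b n).idx
  obtain ⟨m, hm, ⟨rest, last, -, ha⟩, hidx⟩ := hb.exists_axStep_idx n (i - (b n).idx)
  have hidx : (b m).idx = i := by omega
  rcases ha with ⟨-, E, hE, h⟩ | ⟨hsub, -⟩
  · rw [hidx] at hE
    exact ⟨E, hE, m + 1, by simp [h]⟩
  · rw [hidx] at hsub
    exact absurd (fun A hA => hb.Γ_mono hm (hn hA)) hsub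

/-- Both sides grow along the branch, so a common formula would close some node by an identity
axiom. -/
theorem IsInfiniteBranch.not_mem_succedents (hb : IsInfiniteBranch (reductionTree D Γ Δ ord) b)
    {A : Formula} (h : A ∈ antecedents b) : A ∉ succedents b := by
  rintro ⟨n, hn⟩
  obtain ⟨m, hm⟩ := h
  exact hb.not_closed (max m n) (Or.inl ⟨A, hb.Γ_mono (le_max_left _ _) hm,
    hb.Δ_mono (le_max_right _ _) hn⟩)

/-- The logical rule for `A` is applied at step `n` with the term `u` for instantiations. -/
def UsesAt (b : ℕ → Node) (n : ℕ) (A : Formula) (u : Term) : Prop :=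
  ∃ x, ∃ e : Gain, ((A ∈ (b n).Γ ∧ e ∈ leftGains u x A) ∨
      (A ∈ (b n).Δ ∧ e ∈ rightGains u x (b n).Δ A)) ∧
    (b (n + 1)).Γ = (b n).Γ ++ e.1 ∧ (b (n + 1)).Δ = (b n).Δ ++ e.2

theorem IsInfiniteBranch.usesAt_of_mem_used (hb : IsInfiniteBranch (reductionTree D Γ Δ ord) b)
    {n : ℕ} {A : Formula} {u : Term} (h : (A, u) ∈ (b n).used) : ∃ m, UsesAt b m A u := by
  induction n with
  | zero => simp [hb.root] at h
  | succ n ih =>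
    rcases hb.step n with hs | ⟨B, p, rest, -, v, -, e, he, h'⟩
    · exact ih (hs.used ▸ h)
    · rw [h'] at h
      rcases List.mem_cons.1 h with h | h
      · obtain ⟨rfl, rfl⟩ := Prod.mk.inj h
        exact ⟨n, _, e, he, by simp [h'], by simp [h']⟩
      · exact ih h

theorem IsInfiniteBranch.exists_usesAt_ge (hb : IsInfiniteBranch (reductionTree D Γ Δ ord) b)
    {n : ℕ} {A : Formula} (hA : A ∈ (b n).ord) (hat : ¬ A.IsAtomic) :
    ∃ m u, n ≤ m ∧ UsesAt b m A u ∧ FirstUnused (D.terms A) (b m).used A u ∧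
      (A, u) ∈ (b (m + 1)).used := by
  obtain ⟨m, hm, rest, hr⟩ := hb.exists_head hA
  obtain ⟨p, rest, -, u, hu, e, he, h⟩ := hb.logStep_of_cons hr hat
  exact ⟨m, u, hm, ⟨_, e, he, by simp [h], by simp [h]⟩, hu, by simp [h]⟩

theorem IsInfiniteBranch.used_mono (hb : IsInfiniteBranch (reductionTree D Γ Δ ord) b) {m n : ℕ}
    (h : m ≤ n) : (b m).used ⊆ (b n).used := by
  induction n, h using Nat.le_induction with
  | base => simp
  | succ n _ ih =>
    rcases hb.step n with hs | ⟨B, p, rest, -, v, -, e, he, h'⟩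
    · rwa [hs.used]
    · rw [h']
      exact fun q hq => List.mem_cons_of_mem _ (ih hq)

theorem ReductionData.terms_surj (D : ReductionData) (A : Formula) :
    Function.Surjective (D.terms A) := by
  unfold ReductionData.terms
  split
  · exact D.termE_surj
  · exact D.termI_surj

/-- Each further treatment of `A` consumes the first unused term, so every initial segment of the
enumeration is eventually used up. -/
theorem IsInfiniteBranch.exists_usesAt (hb : IsInfiniteBranch (reductionTree D Γ Δ ord) b)
    {n : ℕ} {A : Formula} (hA : A ∈ (b n).ord) (hat : ¬ A.IsAtomic) (u : Term) :
    ∃ m, UsesAt b m A u := by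
  have key : ∀ i, ∃ m, ∀ j < i, (A, D.terms A j) ∈ (b m).used := by
    intro i
    induction i with
    | zero => exact ⟨0, by simp⟩
    | succ i ih =>
      obtain ⟨m, hm⟩ := ih
      obtain ⟨m', v, hm', -, ⟨k, rfl, hk, hlt⟩, hv⟩ :=
        hb.exists_usesAt_ge (hb.ord_mono (le_max_left n m) hA) hat
      have hmm : m ≤ m' := (le_max_right _ _).trans hm'
      refine ⟨m' + 1, fun j hj => ?_⟩
      rcases Nat.lt_succ_iff_lt_or_eq.1 hj with hj | rfl
      · exact hb.used_mono (hmm.trans (Nat.le_succ _)) (hm j hj)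
      -- The term consumed at `m'` has index `k`. If `j < k`, term `j` was used earlier; if `j = k`,
      -- it is used now; `k < j` is impossible, as all terms before `j` were already used.
      · rcases lt_trichotomy j k with hjk | rfl | hjk
        · exact hb.used_mono (Nat.le_succ _) (hlt j hjk)
        · exact hv
        · exact absurd (hb.used_mono hmm (hm k hjk)) hk
  obtain ⟨i, rfl⟩ := D.terms_surj A u
  obtain ⟨m, hm⟩ := key (i + 1)
  exact hb.usesAt_of_mem_used (hm i (Nat.lt_succ_self i))

end Branch

/-! ### Saturated pairs -/

/-- The closure properties of the two sides `G`, `H` of an infinite branch. -/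
structure Saturated (G H : Set Formula) : Prop where
  disjoint : ∀ A ∈ G, A ∉ H
  ax : ∀ s, IsAxiom s → (∀ A ∈ s.1, A ∈ G) → ∃ E ∈ s.2, E ∈ G
  left : ∀ A ∈ G, ¬ A.IsAtomic → ∀ u, ∃ x, ∃ e ∈ leftGains u x A,
    (∀ B ∈ e.1, B ∈ G) ∧ ∀ B ∈ e.2, B ∈ H
  right : ∀ A ∈ H, ¬ A.IsAtomic → ∀ u, ∃ x Δ, ∃ e ∈ rightGains u x Δ A,
    (∀ B ∈ e.1, B ∈ G) ∧ ∀ B ∈ e.2, B ∈ H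
  -- The field `right` leaves the succedent unspecified and so yields only some index; that all
  -- indices occur has to be recorded separately.
  bigOr_rel : ∀ t, .rel (.bigOr t) ∈ H → ∀ k, .rel (.lt t (Tm.iter .c k)) ∈ H
  bigOr_labR : ∀ S t, .labR S (.bigOr t) ∈ H → ∀ k, .labR S (.lt t (Tm.iter .c k)) ∈ H

theorem IsInfiniteBranch.saturated {D : ReductionData} {Γ Δ ord : List Formula} {b : ℕ → Node}
    (hb : IsInfiniteBranch (reductionTree D Γ Δ ord) b)
    (hord : ∀ A, A ∈ Γ ∨ A ∈ Δ → A ∈ ord) : Saturated (antecedents b) (succedents b) := by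
  -- Once all instances below `k` are on the right, the next treatment of the disjunction finds
  -- instance `k` present or adds it, `k` being then the least missing index.
  have bigOr : ∀ (w : RForm → Formula) t, ¬ (w (.bigOr t)).IsAtomic →
      (∀ u x Δ, rightGains u x Δ (w (.bigOr t)) = relRight w u x Δ (.bigOr t)) →
      w (.bigOr t) ∈ succedents b → ∀ k, w (.lt t (Tm.iter .c k)) ∈ succedents b := by
    rintro w t hat hw ⟨n, hn⟩ k
    induction k using Nat.strong_induction_on with
    | _ k ih =>
      have : ∃ m, ∀ j < k, w (.lt t (Tm.iter .c j)) ∈ (b m).Δ := by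
        clear hn
        induction k with
        | zero => exact ⟨0, by simp⟩
        | succ k ih' =>
          obtain ⟨m, hm⟩ := ih' fun j hj => ih j (by omega)
          obtain ⟨m', hm'⟩ := ih k (by omega)
          refine ⟨max m m', fun j hj => ?_⟩
          rcases Nat.lt_succ_iff_lt_or_eq.1 hj with hj | rfl
          · exact hb.Δ_mono (le_max_left _ _) (hm j hj)
          · exact hb.Δ_mono (le_max_right _ _) hm'
      obtain ⟨m, hm⟩ := this
      obtain ⟨m', u, hm', ⟨x, e, he, -, h2⟩, -⟩ := hb.exists_usesAt_ge
        (hb.ord_mono (le_max_left n m) (hb.mem_ord hord n (Or.inr hn))) hat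
      rcases he with ⟨h, -⟩ | ⟨-, he⟩
      · exact absurd ⟨n, hn⟩ (hb.not_mem_succedents ⟨m', h⟩)
      · rw [hw] at he
        obtain ⟨i, hi, rfl⟩ := he
        by_cases hk : w (.lt t (Tm.iter .c k)) ∈ (b m').Δ
        · exact ⟨m', hk⟩
        · have hik : i ≤ k := hi.2 hk
          have hki : k ≤ i := by
            by_contra! hlt
            exact hi.1 (hb.Δ_mono ((le_max_right _ _).trans hm') (hm i hlt))
          obtain rfl : i = k := le_antisymm hik hki
          exact ⟨m' + 1, by simp [h2]⟩
  refine ⟨fun A => hb.not_mem_succedents, fun s => hb.axiom_mem, ?_, ?_,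
    fun t => bigOr .rel t id fun _ _ _ => rfl, fun S t => bigOr (.labR S) t id fun _ _ _ => rfl⟩
  · rintro A ⟨n, hn⟩ hat u
    obtain ⟨m, x, e, he, h1, h2⟩ := hb.exists_usesAt (hb.mem_ord hord n (Or.inl hn)) hat u
    -- `UsesAt` does not say on which side the rule was applied; disjointness excludes the wrong
    -- one.
    rcases he with ⟨-, he⟩ | ⟨h, -⟩
    · exact ⟨x, e, he, fun B hB => ⟨m + 1, by simp [h1, hB]⟩,
        fun B hB => ⟨m + 1, by simp [h2, hB]⟩⟩
    · exact absurd ⟨m, h⟩ (hb.not_mem_succedents ⟨n, hn⟩)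
  · rintro A ⟨n, hn⟩ hat u
    obtain ⟨m, x, e, he, h1, h2⟩ := hb.exists_usesAt (hb.mem_ord hord n (Or.inr hn)) hat u
    rcases he with ⟨h, -⟩ | ⟨-, he⟩
    · exact absurd ⟨n, hn⟩ (hb.not_mem_succedents ⟨m, h⟩)
    · exact ⟨x, _, e, he, fun B hB => ⟨m + 1, by simp [h1, hB]⟩,
        fun B hB => ⟨m + 1, by simp [h2, hB]⟩⟩

/-! ### Relational formulas in a model consisting of terms -/

section Eval

variable {M : Type} (F : Flow M) (σ : ℕ → M)

theorem Tm.eval_weaken {k : ℕ} (e : Fin k → M) :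
    (t : Term) → (Tm.weaken k t).eval F σ e = Term.val F σ t
  | .var _ => rfl
  | .c => rfl
  | .f t => congrArg F.g (Tm.eval_weaken e t)

theorem Tm.eval_inst {k : ℕ} (e : Fin k → M) (u : Term) :
    (t : Tm (k + 1)) → (Tm.inst u t).eval F σ e =
      t.eval F σ (Fin.cons (α := fun _ => M) (Term.val F σ u) e)
  | .var _ => rfl
  | .bnd i => by
      refine Fin.cases ?_ (fun j => ?_) i
      · simp [Tm.inst, Tm.eval, Tm.eval_weaken]
      · simp [Tm.inst, Tm.eval]
  | .c => rfl
  | .f t => congrArg F.g (Tm.eval_inst e u t)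

theorem Term.val_iter (t : Term) (n : ℕ) :
    Term.val F σ (Tm.iter t n) = F.g^[n] (Term.val F σ t) := by
  induction n with
  | zero => rfl
  | succ n ih =>
    rw [Function.iterate_succ_apply', ← ih]
    rfl

/-- Instantiation fills index 0 while quantifiers append a value at the end, so the induction passes
under a quantifier because `Fin.cons` and `Fin.snoc` commute. -/
theorem FinForm.holds_inst (u : Term) : {k : ℕ} → (φ : FinForm (k + 1)) → (e : Fin k → M) →
    ((φ.inst u).Holds F σ e ↔ φ.Holds F σ (Fin.cons (α := fun _ => M) (Term.val F σ u) e))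
  | _, .atom (.eq s t), e => by
      simp [FinForm.inst, Atom.inst, FinForm.Holds, Atom.Holds, Tm.eval_inst]
  | _, .atom (.lt s t), e => by
      simp [FinForm.inst, Atom.inst, FinForm.Holds, Atom.Holds, Tm.eval_inst]
  | _, .neg φ, e => by simp [FinForm.inst, FinForm.Holds, FinForm.holds_inst u φ]
  | _, .and φ ψ, e => by
      simp [FinForm.inst, FinForm.Holds, FinForm.holds_inst u φ, FinForm.holds_inst u ψ]
  | _, .or φ ψ, e => by
      simp [FinForm.inst, FinForm.Holds, FinForm.holds_inst u φ, FinForm.holds_inst u ψ]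
  | _, .imp φ ψ, e => by
      simp [FinForm.inst, FinForm.Holds, FinForm.holds_inst u φ, FinForm.holds_inst u ψ]
  | _, .all φ, e => by
      simp [FinForm.inst, FinForm.Holds, FinForm.holds_inst u φ, Fin.cons_snoc_eq_snoc_cons]
  | _, .ex φ, e => by
      simp [FinForm.inst, FinForm.Holds, FinForm.holds_inst u φ, Fin.cons_snoc_eq_snoc_cons]

/-- With a single bound variable the first and the last position coincide; this connects the
semantics of an outermost quantifier with `FinForm.holds_inst`. -/
theorem snoc_elim0_eq_cons (d : M) :
    (Fin.snoc (α := fun _ => M) Fin.elim0 d : Fin 1 → M) =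
      Fin.cons (α := fun _ => M) d Fin.elim0 := by
  funext i
  obtain rfl := Subsingleton.elim (α := Fin 1) i 0
  rfl

theorem RForm.holds_le (s t : Term) : (RForm.le s t).Holds F σ ↔
    F.lt (Term.val F σ s) (Term.val F σ t) ∨ Term.val F σ s = Term.val F σ t := Iff.rfl

theorem holds_lowerBound (c : Bool) (m : ℕ) (t s : Term) : (lowerBound c m t s).Holds F σ ↔
    F.below c (F.g^[m] (Term.val F σ t)) (Term.val F σ s) := by
  cases c
  · simp only [lowerBound, Flow.below, ← Term.val_iter]
    simp [RForm.Holds, FinForm.Holds, Atom.Holds, Term.val]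
  · simp [lowerBound, Flow.below, RForm.holds_le, Term.val_iter]

theorem holds_upperBound (c : Bool) (m : ℕ) (t s : Term) : (upperBound c m t s).Holds F σ ↔
    F.below c (Term.val F σ s) (F.g^[m] (Term.val F σ t)) := by
  cases c
  · simp only [upperBound, Flow.below, ← Term.val_iter]
    simp [RForm.Holds, FinForm.Holds, Atom.Holds, Term.val]
  · simp [upperBound, Flow.below, RForm.holds_le, Term.val_iter]

/-- The bridge between the bounds written by the box rules and the interval in the semantics of the
box. -/
theorem Ivl.forall_bounds_holds (I : Ivl) (t s : Term) :
    (∀ φ ∈ I.bounds t s, φ.Holds F σ) ↔ I.Mem F (Term.val F σ t) (Term.val F σ s) := by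
  cases I <;> simp [Ivl.bounds, Ivl.Mem, holds_lowerBound, holds_upperBound]

end Eval

/-- The closure properties of the relational formulas of a saturated pair under one fixed label,
or under none. -/
structure RelSaturated (w : RForm → Formula) (G H : Set Formula) : Prop where
  disjoint : ∀ φ, w φ ∈ G → w φ ∉ H
  ax : ∀ Γ Δ, RelAxiom Γ Δ → (∀ φ ∈ Γ, w φ ∈ G) → ∃ ψ ∈ Δ, w ψ ∈ G
  left : ∀ φ, w φ ∈ G → (∀ a, φ ≠ .fin (.atom a)) → ∀ u, ∃ x, ∃ e ∈ relLeft w u x φ,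
    (∀ B ∈ e.1, B ∈ G) ∧ ∀ B ∈ e.2, B ∈ H
  right : ∀ φ, w φ ∈ H → (∀ a, φ ≠ .fin (.atom a)) → ∀ u, ∃ x Δ, ∃ e ∈ relRight w u x Δ φ,
    (∀ B ∈ e.1, B ∈ G) ∧ ∀ B ∈ e.2, B ∈ H
  bigOr : ∀ t, w (.bigOr t) ∈ H → ∀ k, w (.lt t (Tm.iter .c k)) ∈ H

theorem Saturated.relE {G H : Set Formula} (h : Saturated G H) : RelSaturated .rel G H where
  disjoint φ := h.disjoint _
  ax Γ Δ hax hG := by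
    obtain ⟨E, hE, hEG⟩ := h.ax _ (.ext hax) (by simpa using hG)
    obtain ⟨ψ, hψ, rfl⟩ := List.mem_map.1 hE
    exact ⟨ψ, hψ, hEG⟩
  left φ hφ hat := h.left _ hφ (by
    rcases φ with (a | _ | _ | _ | _ | _ | _) | _ | _
    · exact absurd rfl (hat a)
    all_goals exact id)
  right φ hφ hat := h.right _ hφ (by
    rcases φ with (a | _ | _ | _ | _ | _ | _) | _ | _
    · exact absurd rfl (hat a)
    all_goals exact id)
  bigOr := h.bigOr_rel

theorem Saturated.relI {G H : Set Formula} (h : Saturated G H) (S : Term) :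
    RelSaturated (.labR S) G H where
  disjoint φ := h.disjoint _
  ax Γ Δ hax hG := by
    obtain ⟨E, hE, hEG⟩ := h.ax _ (.int S hax) (by simpa using hG)
    obtain ⟨ψ, hψ, rfl⟩ := List.mem_map.1 hE
    exact ⟨ψ, hψ, hEG⟩
  left φ hφ hat := h.left _ hφ (by
    rcases φ with (a | _ | _ | _ | _ | _ | _) | _ | _
    · exact absurd rfl (hat a)
    all_goals exact id)
  right φ hφ hat := h.right _ hφ (by
    rcases φ with (a | _ | _ | _ | _ | _ | _) | _ | _
    · exact absurd rfl (hat a)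
    all_goals exact id)
  bigOr := h.bigOr_labR S

/-! ### Equality reasoning in a saturated set -/

namespace RelSaturated

variable {w : RForm → Formula} {G H : Set Formula}

theorem refl (h : RelSaturated w G H) (t : Term) : w (.eq t t) ∈ G := by
  simpa using h.ax _ _ (.refl t) (by simp)

theorem subst (h : RelSaturated w G H) (ρ : Atom 0) (z : ℕ) {s t : Term} (e : w (.eq s t) ∈ G)
    (hs : w (.fin (.atom (ρ.subst z s))) ∈ G) : w (.fin (.atom (ρ.subst z t))) ∈ G := by
  simpa using h.ax _ _ (.subst ρ z s t) (by simp [e, hs])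

theorem symm (h : RelSaturated w G H) {s t : Term} (e : w (.eq s t) ∈ G) : w (.eq t s) ∈ G := by
  -- The atom is `z = s` with `z` not occurring in `s`: replacing `z` by `s` gives reflexivity,
  -- replacing it by `t` gives the goal. The next lemmas use the same device.
  have := h.subst (.eq (.var (Tm.varBound s)) s) (Tm.varBound s) e
  simp only [Atom.subst, Tm.subst_of_varBound_le s le_rfl, Tm.subst, if_true] at this
  exact this (h.refl s)

theorem trans (h : RelSaturated w G H) {s t u : Term} (e : w (.eq s t) ∈ G)
    (e' : w (.eq t u) ∈ G) : w (.eq s u) ∈ G := by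
  have := h.subst (.eq s (.var (Tm.varBound s))) (Tm.varBound s) e'
  simp only [Atom.subst, Tm.subst_of_varBound_le s le_rfl, Tm.subst, if_true] at this
  exact this e

theorem equivalence (h : RelSaturated w G H) : Equivalence fun s t => w (.eq s t) ∈ G :=
  ⟨h.refl, h.symm, h.trans⟩

theorem congr_f (h : RelSaturated w G H) {s t : Term} (e : w (.eq s t) ∈ G) :
    w (.eq (.f s) (.f t)) ∈ G := by
  have := h.subst (.eq (.f s) (.f (.var (Tm.varBound s)))) (Tm.varBound s) e
  simp only [Atom.subst, Tm.subst_of_varBound_le s le_rfl, Tm.subst, if_true] at this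
  exact this (h.refl _)

theorem congr_lt (h : RelSaturated w G H) {s s' t t' : Term} (e : w (.eq s s') ∈ G)
    (e' : w (.eq t t') ∈ G) (hst : w (.lt s t) ∈ G) : w (.lt s' t') ∈ G := by
  -- The two sides are replaced one after the other, each time with a variable not occurring in the
  -- side that stays.
  have h1 := h.subst (.lt (.var (Tm.varBound t)) t) (Tm.varBound t) e
  simp only [Atom.subst, Tm.subst_of_varBound_le t le_rfl, Tm.subst, if_true] at h1
  have h2 := h.subst (.lt s' (.var (Tm.varBound s'))) (Tm.varBound s') e'
  simp only [Atom.subst, Tm.subst_of_varBound_le s' le_rfl, Tm.subst, if_true] at h2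
  exact h2 (h1 hst)

end RelSaturated

/-- `F`, `σ` is a model whose elements are the values `q t` of terms, and in which an atomic
formula is true iff it lies in `G`. -/
structure Realizes (w : RForm → Formula) (G : Set Formula) {M : Type} (F : Flow M) (σ : ℕ → M)
    (q : Term → M) : Prop where
  surj : Function.Surjective q
  val : ∀ t, Term.val F σ t = q t
  eq_iff : ∀ s t, q s = q t ↔ w (.eq s t) ∈ G
  lt_iff : ∀ s t, F.lt (q s) (q t) ↔ w (.lt s t) ∈ G

/-! ### Truth of relational formulas and the time flow axioms -/

namespace Realizes

variable {w : RForm → Formula} {G H : Set Formula} {M : Type} {F : Flow M} {σ : ℕ → M}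
  {q : Term → M}

theorem iterate_zero (r : Realizes w G F σ q) (n : ℕ) : F.g^[n] F.zero = q (Tm.iter .c n) := by
  rw [← r.val, Term.val_iter]
  rfl

theorem g_apply (r : Realizes w G F σ q) (t : Term) : F.g (q t) = q (.f t) := by
  rw [← r.val, ← r.val]
  rfl

theorem zero_eq (r : Realizes w G F σ q) : F.zero = q .c := r.val .c

theorem holds_atom (r : Realizes w G F σ q) (a : Atom 0) :
    (RForm.fin (.atom a)).Holds F σ ↔ w (.fin (.atom a)) ∈ G := by
  rcases a with ⟨s, t⟩ | ⟨s, t⟩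
  · rw [← r.eq_iff, ← r.val, ← r.val]
    rfl
  · rw [← r.lt_iff, ← r.val, ← r.val]
    rfl

/-- Every element is the value of a term, so quantifying over elements amounts to quantifying over
instances. -/
theorem holds_all (r : Realizes w G F σ q) (φ : FinForm 1) :
    (RForm.fin (.all φ)).Holds F σ ↔ ∀ u, (RForm.fin (φ.inst u)).Holds F σ := by
  simp only [RForm.Holds, FinForm.Holds, FinForm.holds_inst, snoc_elim0_eq_cons, r.val]
  exact r.surj.forall

theorem holds_ex (r : Realizes w G F σ q) (φ : FinForm 1) :
    (RForm.fin (.ex φ)).Holds F σ ↔ ∃ u, (RForm.fin (φ.inst u)).Holds F σ := by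
  simp only [RForm.Holds, FinForm.Holds, FinForm.holds_inst, snoc_elim0_eq_cons, r.val]
  exact r.surj.exists

/-- The induction is on size because an instance is not a subformula. A universal formula on the
left has all its instances there; on the right, one instance by a variable already refutes it. For
existential formulas the sides are exchanged. -/
theorem truth_fin (r : Realizes w G F σ q) (h : RelSaturated w G H) (φ : FinForm 0) :
    (w (.fin φ) ∈ G → (RForm.fin φ).Holds F σ) ∧ (w (.fin φ) ∈ H → ¬ (RForm.fin φ).Holds F σ) := by
  induction hk : φ.size using Nat.strong_induction_on generalizing φ with
  | _ k ih =>
    subst hk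
    cases φ with
    | atom a =>
      rw [r.holds_atom]
      exact ⟨id, fun hH hG => h.disjoint _ hG hH⟩
    | neg φ =>
      have i1 := ih _ (by simp [FinForm.size]) φ rfl
      constructor <;> intro hφ
      -- This rule instantiates nothing, so `.c` is an arbitrary choice of term, as in the other
      -- cases where it appears.
      · obtain ⟨x, e, he, h1, h2⟩ := h.left _ hφ (by simp) .c
        obtain rfl := he
        exact i1.2 (h2 _ (by simp))
      · obtain ⟨x, Δ, e, he, h1, h2⟩ := h.right _ hφ (by simp) .c
        obtain rfl := he
        exact not_not.2 (i1.1 (h1 _ (by simp)))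
    | and φ ψ =>
      have i1 := ih _ (by simp [FinForm.size]) φ rfl
      have i2 := ih _ (by simp [FinForm.size]) ψ rfl
      constructor <;> intro hφ
      · obtain ⟨x, e, he, h1, h2⟩ := h.left _ hφ (by simp) .c
        obtain rfl := he
        exact ⟨i1.1 (h1 _ (by simp)), i2.1 (h1 _ (by simp))⟩
      · obtain ⟨x, Δ, e, he, h1, h2⟩ := h.right _ hφ (by simp) .c
        rintro ⟨a1, a2⟩
        obtain rfl | rfl := he
        · exact i1.2 (h2 _ (by simp)) a1
        · exact i2.2 (h2 _ (by simp)) a2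
    | or φ ψ =>
      have i1 := ih _ (by simp [FinForm.size]) φ rfl
      have i2 := ih _ (by simp [FinForm.size]) ψ rfl
      constructor <;> intro hφ
      · obtain ⟨x, e, he, h1, h2⟩ := h.left _ hφ (by simp) .c
        obtain rfl | rfl := he
        · exact Or.inl (i1.1 (h1 _ (by simp)))
        · exact Or.inr (i2.1 (h1 _ (by simp)))
      · obtain ⟨x, Δ, e, he, h1, h2⟩ := h.right _ hφ (by simp) .c
        obtain rfl := he
        rintro (a | a)
        · exact i1.2 (h2 _ (by simp)) a
        · exact i2.2 (h2 _ (by simp)) a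
    | imp φ ψ =>
      have i1 := ih _ (by simp [FinForm.size]) φ rfl
      have i2 := ih _ (by simp [FinForm.size]) ψ rfl
      constructor <;> intro hφ
      · obtain ⟨x, e, he, h1, h2⟩ := h.left _ hφ (by simp) .c
        intro a
        obtain rfl | rfl := he
        · exact i2.1 (h1 _ (by simp))
        · exact absurd a (i1.2 (h2 _ (by simp)))
      · obtain ⟨x, Δ, e, he, h1, h2⟩ := h.right _ hφ (by simp) .c
        obtain rfl := he
        intro a
        exact i2.2 (h2 _ (by simp)) (a (i1.1 (h1 _ (by simp))))
    | all φ =>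
      have i1 := fun u => ih _ (by simp [FinForm.size, FinForm.size_inst]) (φ.inst u) rfl
      rw [r.holds_all]
      constructor <;> intro hφ
      · intro u
        obtain ⟨x, e, he, h1, h2⟩ := h.left _ hφ (by simp) u
        obtain rfl := he
        exact (i1 u).1 (h1 _ (by simp))
      · obtain ⟨x, Δ, e, he, h1, h2⟩ := h.right _ hφ (by simp) .c
        obtain rfl := he
        exact fun a => (i1 (.var x)).2 (h2 _ (by simp)) (a _)
    | ex φ =>
      have i1 := fun u => ih _ (by simp [FinForm.size, FinForm.size_inst]) (φ.inst u) rfl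
      rw [r.holds_ex]
      constructor <;> intro hφ
      · obtain ⟨x, e, he, h1, h2⟩ := h.left _ hφ (by simp) .c
        obtain rfl := he
        exact ⟨_, (i1 (.var x)).1 (h1 _ (by simp))⟩
      · rintro ⟨u, a⟩
        obtain ⟨x, Δ, e, he, h1, h2⟩ := h.right _ hφ (by simp) u
        obtain rfl := he
        exact (i1 u).2 (h2 _ (by simp)) a

theorem holds_bigOr (r : Realizes w G F σ q) (t : Term) :
    (RForm.bigOr t).Holds F σ ↔ ∃ n, w (.lt t (Tm.iter .c n)) ∈ G := by
  simp [RForm.Holds, r.iterate_zero, r.val, r.lt_iff]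

theorem truth_bigOr (r : Realizes w G F σ q) (h : RelSaturated w G H) (t : Term) :
    (w (.bigOr t) ∈ G → (RForm.bigOr t).Holds F σ) ∧
      (w (.bigOr t) ∈ H → ¬ (RForm.bigOr t).Holds F σ) := by
  rw [r.holds_bigOr]
  refine ⟨fun hφ => ?_, fun hφ ⟨n, hn⟩ => h.disjoint _ hn (h.bigOr t hφ n)⟩
  obtain ⟨x, e, ⟨n, rfl⟩, h1, -⟩ := h.left _ hφ (by simp) .c
  exact ⟨n, h1 _ (by simp)⟩

/-- Relational formulas on the left are true and those on the right are false. -/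
theorem truth (r : Realizes w G F σ q) (h : RelSaturated w G H) (φ : RForm) :
    (w φ ∈ G → φ.Holds F σ) ∧ (w φ ∈ H → ¬ φ.Holds F σ) := by
  rcases φ with φ | t | _
  · exact r.truth_fin h φ
  · exact r.truth_bigOr h t
  · have hall : RForm.allBigOr.Holds F σ ↔ ∀ t, (RForm.bigOr t).Holds F σ := by
      simp only [RForm.Holds, r.val]
      exact r.surj.forall
    rw [hall]
    constructor <;> intro hφ
    · intro u
      obtain ⟨x, e, rfl, h1, -⟩ := h.left _ hφ (by simp) u
      exact (r.truth_bigOr h u).1 (h1 _ (by simp))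
    · obtain ⟨x, Δ, e, rfl, -, h2⟩ := h.right _ hφ (by simp) .c
      exact fun a => (r.truth_bigOr h (.var x)).2 (h2 _ (by simp)) (a _)

/-- Each clause is checked on terms, where it is the corresponding axiom. Density and cofinality
produce non-atomic formulas, which are then decomposed. -/
theorem isTimeFlow (r : Realizes w G F σ q) (h : RelSaturated w G H) : F.IsTimeFlow where
  irrefl := by
    refine r.surj.forall.2 fun s hs => ?_
    simpa using h.ax _ _ (.irrefl s) (by simpa using (r.lt_iff _ _).1 hs)
  trans := by
    refine r.surj.forall.2 fun s => r.surj.forall.2 fun t => r.surj.forall.2 fun u => ?_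
    simp only [r.lt_iff]
    intro h1 h2
    simpa using h.ax _ _ (.trans s t u) (by simp [h1, h2])
  total := by
    refine r.surj.forall.2 fun s => r.surj.forall.2 fun t => ?_
    simp only [r.lt_iff, r.eq_iff]
    simpa using h.ax _ _ (.total s t) (by simp)
  dense := by
    refine r.surj.forall.2 fun s => r.surj.forall.2 fun t => ?_
    rw [r.surj.exists]
    simp only [r.lt_iff]
    intro hst
    have hex := h.ax _ _ (.dense s t) (by simp [hst])
    simp only [List.mem_singleton, exists_eq_left] at hex
    -- The variable introduced for the existential formula of the density axiom names the
    -- intermediate point.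
    obtain ⟨x, e, rfl, h1, -⟩ := h.left _ hex (by simp) .c
    have hand := h1 _ List.mem_cons_self
    simp only [FinForm.inst] at hand
    obtain ⟨y, e, rfl, h1, -⟩ := h.left _ hand (by simp) .c
    simp only [Atom.inst, Tm.inst_weaken, Tm.inst_bnd_zero, List.mem_cons, List.not_mem_nil,
      or_false, forall_eq_or_imp, forall_eq] at h1
    exact ⟨.var x, h1⟩
  least := by
    refine r.surj.forall.2 fun s => ?_
    simp only [r.zero_eq, r.lt_iff, r.eq_iff]
    simpa [or_comm] using h.ax _ _ (.least s) (by simp)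
  no_greatest := by
    refine r.surj.forall.2 fun s => ⟨q (.f s), ?_⟩
    rw [r.lt_iff]
    simpa using h.ax _ _ (.lt_f s) (by simp)
  mono := by
    refine r.surj.forall.2 fun s => r.surj.forall.2 fun t => ?_
    simp only [r.g_apply, r.lt_iff]
    intro hst
    simpa using h.ax _ _ (.mono s t) (by simp [hst])
  lt_g := by
    refine r.surj.forall.2 fun s => ?_
    simp only [r.g_apply, r.lt_iff]
    simpa using h.ax _ _ (.lt_f s) (by simp)
  cofinal := by
    refine r.surj.forall.2 fun s => ?_
    simp only [r.iterate_zero, r.lt_iff]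
    rw [← r.holds_bigOr]
    exact (r.truth_bigOr h s).1 (by simpa using h.ax _ _ (.cofinal s) (by simp))

end Realizes

/-! ### The term model -/

section TermModel

variable {G H : Set Formula}

theorem Saturated.labelAtom (h : Saturated G H) {S T : Term} (e : EqE G S T) (ρ : Atom 0)
    (hρ : .labR S (.fin (.atom ρ)) ∈ G) : .labR T (.fin (.atom ρ)) ∈ G := by
  simpa using h.ax _ (.labelR S T ρ) (by simpa using ⟨e, hρ⟩)

theorem Saturated.labelLab (h : Saturated G H) {S T : Term} (e : EqE G S T) (t : Term)
    (ψ : ITemp) (hψ : .labT S (.lab t ψ) ∈ G) : .labT T (.lab t ψ) ∈ G := by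
  simpa using h.ax _ (.labelT S T t ψ) (by simpa using ⟨e, hψ⟩)

theorem Saturated.wellDefined (h : Saturated G H) : WellDefined G where
  equivE := h.relE.equivalence
  congF _ _ := h.relE.congr_f
  congLtE _ _ _ _ := h.relE.congr_lt
  equivI S := (h.relI S).equivalence
  congf S _ _ := (h.relI S).congr_f
  congLtI S _ _ _ _ := (h.relI S).congr_lt
  congProp S p t u e hp := by
    simpa [PropI] using h.ax _ (.labelI S t u p) (by simpa using ⟨e, hp⟩)
  labelEq _ _ _ _ e := h.labelAtom e _
  labelLt _ _ _ _ e := h.labelAtom e _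
  labelProp _ _ p t e := h.labelLab e t (.prop p)

theorem realizes_flowE (h : WellDefined G) :
    Realizes .rel G (flowE h) (fun X => Quotient.mk (setoidE h) (.var X))
      (Quotient.mk (setoidE h)) where
  surj := Quotient.exists_rep
  val t := by
    induction t using Tm.varBound.induct with
    | case1 x => rfl
    | case2 => rfl
    | case3 t ih => exact congrArg (flowE h).g ih
  eq_iff s t := ⟨fun e => Quotient.exact (s := setoidE h) e,
    fun e => Quotient.sound (s := setoidE h) e⟩
  lt_iff s t := Iff.rfl

/-- The relation at a class asks for some representative as label; replacing equal labels moves the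
equation to `S` itself. -/
theorem setoidI_iff (h : WellDefined G) (S t u : Term) :
    Quotient.mk (setoidI h (Quotient.mk (setoidE h) S)) t =
      Quotient.mk (setoidI h (Quotient.mk (setoidE h) S)) u ↔ EqI G S t u := by
  constructor
  · intro e
    obtain ⟨T, hT, e⟩ := Quotient.exact (s := setoidI h _) e
    exact h.labelEq T S t u (Quotient.exact (s := setoidE h) hT) e
  · exact fun e => Quotient.sound (s := setoidI h _) ⟨S, rfl, e⟩

theorem realizes_flowN (h : WellDefined G) (S : Term) :
    Realizes (.labR S) G (flowN h (Quotient.mk (setoidE h) S))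
      (fun x => Quotient.mk (setoidI h (Quotient.mk (setoidE h) S)) (.var x))
      (Quotient.mk (setoidI h (Quotient.mk (setoidE h) S))) where
  surj := Quotient.exists_rep
  val t := by
    induction t using Tm.varBound.induct with
    | case1 x => rfl
    | case2 => rfl
    | case3 t ih => exact congrArg (flowN h (Quotient.mk (setoidE h) S)).g ih
  eq_iff := setoidI_iff h S
  lt_iff s t := by
    constructor
    · rintro ⟨T, s', t', hT, hs, ht, hlt⟩
      -- The representatives are changed in two stages: first the external label, then the two
      -- internal terms.
      have hlt := h.labelLt T S _ _ (Quotient.exact (s := setoidE h) hT) hlt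
      exact h.congLtI S _ _ _ _ ((setoidI_iff h S _ _).1 hs) ((setoidI_iff h S _ _).1 ht) hlt
    · exact fun hlt => ⟨S, s, t, rfl, rfl, rfl, hlt⟩

theorem mem_val_iff (h : WellDefined G) (S t : Term) (p : ℕ) :
    Quotient.mk (setoidI h (Quotient.mk (setoidE h) S)) t ∈
      (termModel h).val (Quotient.mk (setoidE h) S) p ↔ .labT S (.lab t (.prop p)) ∈ G := by
  constructor
  · rintro ⟨T, s, hT, hs, hp⟩
    exact h.congProp S p s t ((setoidI_iff h S _ _).1 hs)
      (h.labelProp T S p s (Quotient.exact (s := setoidE h) hT) hp)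
  · exact fun hp => ⟨S, t, rfl, rfl, hp⟩

/-- The external label stays fixed, while the induction ranges over all internal terms, since a box
moves from one point to another. -/
theorem Saturated.truth_lab (h : Saturated G H) (hw : WellDefined G) (S : Term) (ψ : ITemp) :
    ∀ t, (.labT S (.lab t ψ) ∈ G → ψ.Holds (flowN hw (Quotient.mk (setoidE hw) S))
        ((termModel hw).val (Quotient.mk (setoidE hw) S))
        (Quotient.mk (setoidI hw (Quotient.mk (setoidE hw) S)) t)) ∧
      (.labT S (.lab t ψ) ∈ H → ¬ ψ.Holds (flowN hw (Quotient.mk (setoidE hw) S))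
        ((termModel hw).val (Quotient.mk (setoidE hw) S))
        (Quotient.mk (setoidI hw (Quotient.mk (setoidE hw) S)) t)) := by
  have r := realizes_flowN hw S
  induction ψ with
  | prop p =>
    intro t
    exact ⟨(mem_val_iff hw S t p).2, fun hH hG => h.disjoint _ ((mem_val_iff hw S t p).1 hG) hH⟩
  | neg φ i1 =>
    intro t
    constructor <;> intro hφ
    -- Here `id` proves non-atomicity, because `IsAtomic` reduces to `False`.
    · obtain ⟨x, e, he, h1, h2⟩ := h.left _ hφ id .c
      obtain rfl := he
      exact (i1 t).2 (h2 _ (by simp))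
    · obtain ⟨x, Δ, e, he, h1, h2⟩ := h.right _ hφ id .c
      obtain rfl := he
      exact not_not.2 ((i1 t).1 (h1 _ (by simp)))
  | and φ ψ i1 i2 =>
    intro t
    constructor <;> intro hφ
    · obtain ⟨x, e, he, h1, h2⟩ := h.left _ hφ id .c
      obtain rfl := he
      exact ⟨(i1 t).1 (h1 _ (by simp)), (i2 t).1 (h1 _ (by simp))⟩
    · obtain ⟨x, Δ, e, he, h1, h2⟩ := h.right _ hφ id .c
      rintro ⟨a1, a2⟩
      obtain rfl | rfl := he
      · exact (i1 t).2 (h2 _ (by simp)) a1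
      · exact (i2 t).2 (h2 _ (by simp)) a2
  | or φ ψ i1 i2 =>
    intro t
    constructor <;> intro hφ
    · obtain ⟨x, e, he, h1, h2⟩ := h.left _ hφ id .c
      obtain rfl | rfl := he
      · exact Or.inl ((i1 t).1 (h1 _ (by simp)))
      · exact Or.inr ((i2 t).1 (h1 _ (by simp)))
    · obtain ⟨x, Δ, e, he, h1, h2⟩ := h.right _ hφ id .c
      obtain rfl := he
      rintro (a | a)
      · exact (i1 t).2 (h2 _ (by simp)) a
      · exact (i2 t).2 (h2 _ (by simp)) a
  | imp φ ψ i1 i2 =>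
    intro t
    constructor <;> intro hφ
    · obtain ⟨x, e, he, h1, h2⟩ := h.left _ hφ id .c
      intro a
      obtain rfl | rfl := he
      · exact (i2 t).1 (h1 _ (by simp))
      · exact absurd a ((i1 t).2 (h2 _ (by simp)))
    · obtain ⟨x, Δ, e, he, h1, h2⟩ := h.right _ hφ id .c
      obtain rfl := he
      exact fun a => (i2 t).2 (h2 _ (by simp)) (a ((i1 t).1 (h1 _ (by simp))))
  | box I φ i1 =>
    intro t
    constructor <;> intro hφ
    · refine r.surj.forall.2 fun u hu => ?_
      rw [← r.val, ← r.val, ← Ivl.forall_bounds_holds] at hu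
      obtain ⟨x, e, he, h1, h2⟩ := h.left _ hφ id u
      obtain ⟨ψ, hψ, rfl⟩ | rfl := he
      -- A child that puts a bound on the right makes that bound false, although `u` lies in the
      -- interval.
      · exact absurd (hu ψ hψ) ((r.truth (h.relI S) ψ).2 (h2 _ (by simp)))
      · exact (i1 u).1 (h1 _ (by simp))
    · obtain ⟨x, Δ, e, he, h1, h2⟩ := h.right _ hφ id .c
      obtain rfl := he
      -- The new variable names a point of the interval, its bounds being on the left, at which the
      -- body fails.
      refine fun a => (i1 (.var x)).2 (h2 _ (by simp)) (a _ ?_)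
      rw [← r.val, ← r.val, ← Ivl.forall_bounds_holds]
      exact fun ψ hψ => (r.truth (h.relI S) ψ).1 (h1 _ (List.mem_map_of_mem hψ))

theorem Saturated.truth_labT (h : Saturated G H) (hw : WellDefined G) (α : ETemp) :
    ∀ S, (.labT S α ∈ G → α.Holds (termModel hw) (Quotient.mk (setoidE hw) S)) ∧
      (.labT S α ∈ H → ¬ α.Holds (termModel hw) (Quotient.mk (setoidE hw) S)) := by
  have r := realizes_flowE hw
  induction α with
  | lab t ψ =>
    intro S
    have := h.truth_lab hw S ψ t
    -- The semantics speaks of the value of `t`, the internal truth lemma of its class; they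
    -- coincide.
    rwa [← (realizes_flowN hw S).val t] at this
  | neg φ i1 =>
    intro t
    constructor <;> intro hφ
    · obtain ⟨x, e, he, h1, h2⟩ := h.left _ hφ id .c
      obtain rfl := he
      exact (i1 t).2 (h2 _ (by simp))
    · obtain ⟨x, Δ, e, he, h1, h2⟩ := h.right _ hφ id .c
      obtain rfl := he
      exact not_not.2 ((i1 t).1 (h1 _ (by simp)))
  | and φ ψ i1 i2 =>
    intro t
    constructor <;> intro hφ
    · obtain ⟨x, e, he, h1, h2⟩ := h.left _ hφ id .c
      obtain rfl := he
      exact ⟨(i1 t).1 (h1 _ (by simp)), (i2 t).1 (h1 _ (by simp))⟩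
    · obtain ⟨x, Δ, e, he, h1, h2⟩ := h.right _ hφ id .c
      rintro ⟨a1, a2⟩
      obtain rfl | rfl := he
      · exact (i1 t).2 (h2 _ (by simp)) a1
      · exact (i2 t).2 (h2 _ (by simp)) a2
  | or φ ψ i1 i2 =>
    intro t
    constructor <;> intro hφ
    · obtain ⟨x, e, he, h1, h2⟩ := h.left _ hφ id .c
      obtain rfl | rfl := he
      · exact Or.inl ((i1 t).1 (h1 _ (by simp)))
      · exact Or.inr ((i2 t).1 (h1 _ (by simp)))
    · obtain ⟨x, Δ, e, he, h1, h2⟩ := h.right _ hφ id .c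
      obtain rfl := he
      rintro (a | a)
      · exact (i1 t).2 (h2 _ (by simp)) a
      · exact (i2 t).2 (h2 _ (by simp)) a
  | imp φ ψ i1 i2 =>
    intro t
    constructor <;> intro hφ
    · obtain ⟨x, e, he, h1, h2⟩ := h.left _ hφ id .c
      intro a
      obtain rfl | rfl := he
      · exact (i2 t).1 (h1 _ (by simp))
      · exact absurd a ((i1 t).2 (h2 _ (by simp)))
    · obtain ⟨x, Δ, e, he, h1, h2⟩ := h.right _ hφ id .c
      obtain rfl := he
      exact fun a => (i2 t).2 (h2 _ (by simp)) (a ((i1 t).1 (h1 _ (by simp))))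
  | box I φ i1 =>
    intro t
    constructor <;> intro hφ
    · refine r.surj.forall.2 fun u hu => ?_
      rw [← r.val, ← r.val] at hu
      have hu := (Ivl.forall_bounds_holds _ _ I t u).2 hu
      obtain ⟨x, e, he, h1, h2⟩ := h.left _ hφ id u
      obtain ⟨ψ, hψ, rfl⟩ | rfl := he
      · exact absurd (hu ψ hψ) ((r.truth h.relE ψ).2 (h2 _ (by simp)))
      · exact (i1 u).1 (h1 _ (by simp))
    · obtain ⟨x, Δ, e, he, h1, h2⟩ := h.right _ hφ id .c
      obtain rfl := he
      refine fun a => (i1 (.var x)).2 (h2 _ (by simp)) (a _ ?_)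
      rw [← r.val, ← r.val]
      exact (Ivl.forall_bounds_holds _ _ I t _).1
        fun ψ hψ => (r.truth h.relE ψ).1 (h1 _ (List.mem_map_of_mem hψ))

theorem Saturated.isStructure (h : Saturated G H) (hw : WellDefined G) :
    (termModel hw).IsStructure :=
  ⟨(realizes_flowE hw).isTimeFlow h.relE,
    Quotient.ind fun S => (realizes_flowN hw S).isTimeFlow (h.relI S)⟩

/-- In the term model the formulas on the left are true and those on the right are false. -/
theorem Saturated.truth (h : Saturated G H) (hw : WellDefined G) (A : Formula) :
    (A ∈ G → (termModel hw).Sat A) ∧ (A ∈ H → ¬ (termModel hw).Sat A) := by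
  have hv : ∀ S, Term.val (termModel hw).flow (termModel hw).σ S = Quotient.mk (setoidE hw) S :=
    (realizes_flowE hw).val
  rcases A with φ | ⟨S, φ⟩ | ⟨S, α⟩
  · exact (realizes_flowE hw).truth h.relE φ
  · simp only [Interp.Sat]
    rw [hv]
    exact (realizes_flowN hw S).truth (h.relI S) φ
  · simp only [Interp.Sat]
    rw [hv]
    exact h.truth_labT hw α S

end TermModel

end MTL2

/-! ### The main theorem -/

theorem mainTheorem3 (D : MTL2.ReductionData) (Γ Δ ord : List MTL2.Formula)
    (hord : ∀ A, A ∈ ord ↔ A ∈ Γ ∨ A ∈ Δ) (b : ℕ → MTL2.Node)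
    (hb : MTL2.IsInfiniteBranch (MTL2.reductionTree D Γ Δ ord) b) :
    ∃ h : MTL2.WellDefined (MTL2.antecedents b),
      (MTL2.termModel h).IsStructure ∧
      (∀ A ∈ MTL2.antecedents b, (MTL2.termModel h).Sat A) ∧
      (∀ A ∈ MTL2.succedents b, ¬ (MTL2.termModel h).Sat A) ∧
      ¬ (MTL2.termModel h).SatSeq (Γ, Δ) := by
  have hsat := hb.saturated fun A hA => (hord A).2 hA
  have hw := hsat.wellDefined
  have h1 := fun A => (hsat.truth hw A).1
  have h2 := fun A => (hsat.truth hw A).2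
  refine ⟨hw, hsat.isStructure hw, h1, h2, ?_⟩
  rintro (⟨A, hA, hn⟩ | ⟨A, hA, hs⟩)
  -- Stage 0 of the branch is the root, so the given sequent is contained in the two unions.
  · exact hn (h1 A ⟨0, by rw [hb.root]; exact hA⟩)
  · exact h2 A ⟨0, by rw [hb.root]; exact hA⟩ hs
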